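/- For $N\ge 1$ consider agents $0,1,\dots,N$ on the line with orbits $z_0,\dots,z_N$. Let $g_x<0$, $g_v<0$, $\rho_{x,0}=\rho_{v,0}=1$, $\rho_{x,-1}=\rho_{x,1}=-\tfrac12$ and $\rho_{v,-1}+\rho_{v,1}=-1$. A *unit pulse* is a differentiable, compactly supported function $p:\mathbb R\to\mathbb R$ with $\int p=1$. Let $P_N$ be the system in which the leader performs $z_0(t)=p(t)v_0$, all agents are at rest at $0$ before the pulse, $$\ddot z_k=g_x\left[\rho_{x,-1}z_{k-1}+\rho_{x,0}z_k+\rho_{x,1}z_{k+1}\right]+g_v\left[\rho_{v,-1}\dot z_{k-1}+\rho_{v,0}\dot z_k+\rho_{v,1}\dot z_{k+1}\right]\qquad(1\le k\le N-1),$$ $$\ddot z_N=g_x\beta_x\left[-z_{N-1}+z_N\right]+g_v\beta_v\left[-\dot z_{N-1}+\dot z_N\right],$$ with either $(\beta_x,\beta_v)=(-\rho_{x,-1},-\rho_{v,-1})$ (variable mass boundary condition) or $(\beta_x,\beta_v)=(1,1)$ (regular boundary condition). Put $$c_\pm=-\frac{g_v(1+2\rho_{v,1})}{2}\pm\sqrt{\frac{g_v^2(1+2\rho_{v,1})^2}{4}-\frac{g_x}{2}},$$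 so that $c_-<0<c_+$. Fix these parameters, a unit pulse $p$, a real $v_0$ and $K>1$, and let $W_N=\left[\frac{N}{|c_-|},K\frac{N}{|c_-|}\right]\cap\left[\frac{N}{c_+},K\frac{N}{c_+}\right]$. Then, as $N\to\infty$, the orbit of the last agent of $P_N$ tends on $W_N$ to the reflection series: there are unit pulses $f_k=f_{N,k}$ ($k\ge0$) with supports in $[-r_N,r_N]$, where $r_N/N\to0$, such that $$z_N(t)-\frac{c_+-c_-}{c_+}\sum_{k=0}^{\infty}\left(\frac{c_-}{c_+}\right)^k f_{N,k}\!\left(t-\frac{N}{c_+}-\left(\frac1{c_+}-\frac1{c_-}\right)kN\right)v_0$$ converges to $0$ as $N\to\infty$, both uniformly on $t\in W_N$ and in $L^1(W_N)$. (For each $t$ the sum has finitely many nonzero terms.) -/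

import Mathlib

open Filter Topology Set MeasureTheory

noncomputable section

/-- Coefficients of a linear nearest neighbour flock: the gains `gx`, `gv` and the weights
`ρx i`, `ρv i` (`m` stands for the index `-1`, i.e. the neighbour in front, on the leader's
side; `p` for the index `+1`, the neighbour behind). -/
structure Flock where
  gx : ℝ
  gv : ℝ
  ρxm : ℝ
  ρx0 : ℝ
  ρxp : ℝ
  ρvm : ℝ
  ρv0 : ℝ
  ρvp : ℝ

/-- The normalized parameters. -/
structure Flock.Normalized (F : Flock) : Prop where
  x_center : F.ρx0 = 1
  v_center : F.ρv0 = 1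
  x_front : F.ρxm = -1 / 2
  x_back : F.ρxp = -1 / 2
  v_sum : F.ρvm + F.ρv0 + F.ρvp = 0
  gx_neg : F.gx < 0
  gv_neg : F.gv < 0

/-- The two boundary conditions for the last agent. -/
inductive LastAgent where
  | variableMass
  | regular

/-- The coefficient `β_x` in the equation of the last agent. -/
def LastAgent.βx (b : LastAgent) (F : Flock) : ℝ :=
  match b with
  | .variableMass => -F.ρxm
  | .regular => 1

/-- The coefficient `β_v` in the equation of the last agent. -/
def LastAgent.βv (b : LastAgent) (F : Flock) : ℝ :=
  match b with
  | .variableMass => -F.ρvm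
  | .regular => 1

/-- A unit pulse: a compactly supported function of integral one, differentiable (so that the
velocity of a leader that performs it makes sense; in particular it is integrable). -/
structure IsUnitPulse (p : ℝ → ℝ) : Prop where
  differentiable : Differentiable ℝ p
  compactSupport : HasCompactSupport p
  integral_eq_one : ∫ s, p s = 1

/-- `z` (with `z k` the orbit of agent `k`, only `k ≤ N` being relevant) is the motion of the
array of agents `0, …, N` whose leader performs the pulse `p(t) v₀` and which is at rest before
the pulse. -/
structure IsPulseMotion (F : Flock) (b : LastAgent) (p : ℝ → ℝ) (v₀ : ℝ) (N : ℕ)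
    (z : ℕ → ℝ → ℝ) : Prop where
  leader : ∀ t, z 0 t = p t * v₀
  rest : ∃ t₀ : ℝ, ∀ k ≤ N, ∀ t ≤ t₀, z k t = 0
  position_differentiable : ∀ k ≤ N, Differentiable ℝ (z k)
  velocity_differentiable : ∀ k, 1 ≤ k → k ≤ N → Differentiable ℝ (deriv (z k))
  interior : ∀ k, 1 ≤ k → k < N → ∀ t,
    deriv (deriv (z k)) t =
      F.gx * (F.ρxm * z (k - 1) t + F.ρx0 * z k t + F.ρxp * z (k + 1) t) +
      F.gv * (F.ρvm * deriv (z (k - 1)) t + F.ρv0 * deriv (z k) t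
        + F.ρvp * deriv (z (k + 1)) t)
  last : ∀ t,
    deriv (deriv (z N)) t =
      F.gx * b.βx F * (-z (N - 1) t + z N t) +
      F.gv * b.βv F * (-deriv (z (N - 1)) t + deriv (z N) t)

/-- The signal velocity `c₊`. -/
def Flock.cPlus (F : Flock) : ℝ :=
  -(F.gv * (1 + 2 * F.ρvp)) / 2 + √(F.gv ^ 2 * (1 + 2 * F.ρvp) ^ 2 / 4 - F.gx / 2)

/-- The signal velocity `c₋`. -/
def Flock.cMinus (F : Flock) : ℝ :=
  -(F.gv * (1 + 2 * F.ρvp)) / 2 - √(F.gv ^ 2 * (1 + 2 * F.ρvp) ^ 2 / 4 - F.gx / 2)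

/-- The time window `[N/|c₋|, K N/|c₋|] ∩ [N/c₊, K N/c₊]`. -/
def Flock.window (F : Flock) (K : ℝ) (N : ℕ) : Set ℝ :=
  Icc (N / |F.cMinus|) (K * (N / |F.cMinus|)) ∩ Icc (N / F.cPlus) (K * (N / F.cPlus))

/-- The reflection series with pulse shapes `f 0, f 1, …`, at time `t`. When the supports of the
`f k` lie in one bounded set, only finitely many terms are nonzero for each `t`. -/
def Flock.reflectionSeries (F : Flock) (v₀ : ℝ) (N : ℕ) (f : ℕ → ℝ → ℝ) (t : ℝ) : ℝ :=
  (F.cPlus - F.cMinus) / F.cPlus *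
    (∑' k : ℕ, (F.cMinus / F.cPlus) ^ k *
      f k (t - N / F.cPlus - (1 / F.cPlus - 1 / F.cMinus) * k * N)) * v₀

end

/-! Put `α = -gx`, `β = -gv`, `d = drift`, `c = c₊ = speed α d`, `c' = |c₋| = speed α (-d)`. After a
bilateral Laplace transform in time, the interior equations form a three-term recursion in the agent
index with characteristic roots `u = mult α β d s` and `1 / w`, where `w = mult α β (-d) s`.
Together with the boundary condition this gives the transfer function `u ^ n * gain / (1 + reflCoeff
* (u * w) ^ n)` from the leader to agent `n + 1` (`IsPulseMotion.transfer`). Its expansion in powers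
of `-reflCoeff * (u * w) ^ n` is the series of reflections, one factor per round trip.

Near the origin `u ≈ exp (-s / c)` and `w ≈ exp (-s / c')`, and damping makes both moduli decrease
with `|Im s|`; on the rest of the imaginary axis they are less than one. Hence, for `|Re s| ≤ 1 /
√n`, `|u| ^ n` is at most a constant times `exp (-n Re s / c) / (1 + κ n (Im s) ^ 2)`
(`exists_pow_bound`). Inversion along the lines `Re s = ±1 / √n` shows that the term with `k`
reflections is concentrated within `O(√n)` of its arrival time (`exists_pulse_bound`). Its integral
is the value of its transform at `0`, namely `(1 + c' / c) * (-(c' / c)) ^ k` for both boundary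
conditions. Cutting it off at distance `N ^ (3 / 4)` and correcting the mass turns it into a
multiple of a unit pulse (`exists_pulses`).

The geometric series may diverge near the imaginary axis, so it is stopped after `m` terms. On a
line `Re s = σ` where `|u|, |w| ≤ 1 / e` the remainder is `O(exp (σ t - 2 n m))`
(`exists_expansion`). Since the growth exponent of the motions, and with it `σ`, does not depend on
`N`, a fixed large `m` makes this negligible for `t ≤ K N / c`. -/

namespace Dispersion

/-! ### Spatial characteristic roots -/

/-- The discriminant of the dispersion relation, divided by `s ^ 2`. -/
noncomputable def disc (α β d : ℝ) (s : ℂ) : ℂ := s ^ 2 + 2 * β * s + (2 * α + 4 * d ^ 2)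

/-- The principal square root of the discriminant. -/
noncomputable def rt (α β d : ℝ) (s : ℂ) : ℂ := disc α β d s ^ (2⁻¹ : ℂ)

/-- Half the sum of the root of the discriminant and the frequency. -/
noncomputable def half (α β d : ℝ) (s : ℂ) : ℂ := (rt α β d s + s) / 2

/-- The multiplier from one agent to the next: the spatial characteristic root inside the unit
disc. The reciprocal of the other characteristic root is the multiplier with `-d` for `d`. -/
noncomputable def mult (α β d : ℝ) (s : ℂ) : ℂ := 1 - s / (half α β d s + d)

/-- The ratio of the two propagation factors. -/
noncomputable def ratio (α β d : ℝ) (s : ℂ) : ℂ := (half α β d s - d) / (half α β d s + d)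

/-- The reciprocal of `1 + mult α β (-d) s`. -/
noncomputable def invOneAdd (α β d : ℝ) (s : ℂ) : ℂ :=
  (half α β d s - d) / (rt α β d s - 2 * d)

/-- The points where all the functions of this section are regular. -/
structure Regular (α β d : ℝ) (s : ℂ) : Prop where
  slit : disc α β d s ∈ Complex.slitPlane
  add_ne : half α β d s + d ≠ 0
  sub_ne : half α β d s - d ≠ 0
  rt_sub_ne : rt α β d s - 2 * d ≠ 0
  rt_add_ne : rt α β d s + 2 * d ≠ 0

variable {α β d : ℝ} {s : ℂ}

lemma disc_neg : disc α β (-d) s = disc α β d s := by simp [disc]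

lemma rt_neg : rt α β (-d) s = rt α β d s := by simp [rt, disc_neg]

lemma half_neg : half α β (-d) s = half α β d s := by simp [half, rt_neg]

lemma rt_sq : rt α β d s ^ 2 = disc α β d s := Complex.cpow_ofNat_inv_pow _ 2

lemma rt_re_nonneg : 0 ≤ (rt α β d s).re := by
  rw [rt, Complex.cpow_inv_two_re]
  positivity

/-- This quadratic relation replaces the square root in all the algebra below. -/
lemma half_sq : half α β d s ^ 2 - half α β d s * s = (2 * β * s + (2 * α + 4 * d ^ 2)) / 4 := by
  have h := rt_sq (α := α) (β := β) (d := d) (s := s)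
  rw [disc] at h
  rw [half]
  linear_combination h / 4

lemma Regular.neg (h : Regular α β d s) : Regular α β (-d) s where
  slit := by rw [disc_neg]; exact h.slit
  add_ne := by rw [half_neg]; push_cast; simpa [sub_eq_add_neg] using h.sub_ne
  sub_ne := by rw [half_neg]; push_cast; simpa using h.add_ne
  rt_sub_ne := by rw [rt_neg]; push_cast; simpa using h.rt_add_ne
  rt_add_ne := by rw [rt_neg]; push_cast; simpa [sub_eq_add_neg] using h.rt_sub_ne

lemma disc_re : (disc α β d s).re
    = s.re ^ 2 - s.im ^ 2 + 2 * β * s.re + (2 * α + 4 * d ^ 2) := by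
  simp [disc, pow_two]

lemma disc_im : (disc α β d s).im = 2 * s.im * (s.re + β) := by
  simp [disc, pow_two]; ring

/-- The imaginary part `2 * s.im * (s.re + β)` vanishes only on the real axis, and there the
discriminant is at least `2 * (α - η * β) > 0`. -/
lemma disc_mem_slitPlane (hβ : 0 < β) {η : ℝ} (h1 : η < β) (h2 : η * β < α)
    (hs : -η ≤ s.re) : disc α β d s ∈ Complex.slitPlane := by
  rw [Complex.mem_slitPlane_iff]
  by_cases him : s.im = 0
  · left
    rw [disc_re, him]
    nlinarith [sq_nonneg s.re, sq_nonneg d]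
  · right
    rw [disc_im]
    have : s.re + β ≠ 0 := by linarith
    positivity

/-- A zero forces `s * (2 * d - β) = α`. For `-η ≤ s.re < 0` the left side is too small; for `s.re ≥
0` it forces `d > 0`, whereas the real part of `half = -d` is nonnegative. -/
lemma half_add_ne_zero (hα : 0 < α) (hβ : 0 < β) {η : ℝ} (h1 : η * (|2 * d| + β) < α)
    (hs : -η ≤ s.re) : half α β d s + d ≠ 0 := by
  intro h
  have h0 : half α β d s = -d := by linear_combination h
  have h2 := half_sq (α := α) (β := β) (d := d) (s := s)
  rw [h0] at h2
  have h3 : s * ((2 * d - β : ℝ) : ℂ) = (α : ℂ) := by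
    push_cast
    linear_combination 2 * h2
  have hre : s.re * (2 * d - β) = α := by simpa using congrArg Complex.re h3
  rcases lt_or_ge s.re 0 with hneg | hpos
  · have := neg_abs_le (2 * d)
    have hη : 0 ≤ |2 * d| + β := by positivity
    have h5 : s.re * (2 * d - β) ≤ -s.re * (|2 * d| + β) := by nlinarith
    nlinarith
  · have hd : 0 < d := by
      by_contra hd
      nlinarith
    have h4 := congrArg Complex.re h0
    have h5 := rt_re_nonneg (α := α) (β := β) (d := d) (s := s)
    have h6 : (half α β d s).re = ((rt α β d s).re + s.re) / 2 := by simp [half]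
    simp at h4
    linarith

/-- If `rt = 2 * d`, the discriminant with `d = 0` vanishes, but it lies in the slit plane too. -/
lemma rt_sub_ne_zero (hβ : 0 < β) {η : ℝ} (h1 : η < β) (h2 : η * β < α)
    (hs : -η ≤ s.re) : rt α β d s - 2 * d ≠ 0 := by
  intro h
  have h3 : disc α β 0 s = 0 := by
    have h4 := rt_sq (α := α) (β := β) (d := d) (s := s)
    rw [disc] at h4 ⊢
    push_cast
    linear_combination -h4 + (rt α β d s + 2 * d) * h
  have := disc_mem_slitPlane (d := 0) hβ h1 h2 hs
  rw [h3] at this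
  simp at this

/-- All functions of this section are regular on a half plane containing the imaginary axis. -/
lemma exists_regular (hα : 0 < α) (hβ : 0 < β) (d : ℝ) :
    ∃ η > 0, η ≤ 1 / 2 ∧ η ≤ β / 2 ∧ ∀ s : ℂ, -η ≤ s.re → Regular α β d s := by
  set η := min (min (1 / 2) (β / 2)) (α / (2 * (|2 * d| + β)))
  have hp : 0 < |2 * d| + β := by positivity
  have hη : 0 < η := by positivity
  have e1 : η ≤ 1 / 2 := (min_le_left _ _).trans (min_le_left _ _)
  have e2 : η ≤ β / 2 := (min_le_left _ _).trans (min_le_right _ _)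
  have e3 : η * (|2 * d| + β) < α := by
    have : η ≤ α / (2 * (|2 * d| + β)) := min_le_right _ _
    rw [le_div_iff₀ (by positivity)] at this
    linarith
  have e4 : η * β < α := by nlinarith [abs_nonneg (2 * d)]
  refine ⟨η, hη, e1, e2, fun s hs => ⟨?_, ?_, ?_, ?_, ?_⟩⟩
  · exact disc_mem_slitPlane hβ (by linarith) e4 hs
  · exact half_add_ne_zero hα hβ e3 hs
  · have := half_add_ne_zero (d := -d) hα hβ (by simpa [abs_neg] using e3) hs
    rw [half_neg] at this
    simpa [sub_eq_add_neg] using this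
  · exact rt_sub_ne_zero hβ (by linarith) e4 hs
  · have := rt_sub_ne_zero (d := -d) hβ (by linarith) e4 hs
    rw [rt_neg] at this
    simpa using this

section Algebra

lemma mult_neg (s : ℂ) : mult α β (-d) s = 1 - s / (half α β d s - d) := by
  rw [mult, half_neg]; push_cast; rw [sub_eq_add_neg (half α β d s)]

/-- After multiplication by `2 * (half - d) * (half + d)`, the quantities `u`, `w` and `(1 - u) * (1
- w)` become twice the coefficients of the front neighbour, of the rear neighbour and of the
acceleration in the transformed equation of motion. -/
lemma mult_mul_half (h : Regular α β d s) :
    mult α β d s * (2 * ((half α β d s - d) * (half α β d s + d))) = α + β * s + 2 * d * s := by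
  have h1 := h.add_ne
  have h2 := half_sq (α := α) (β := β) (d := d) (s := s)
  rw [mult]
  field_simp
  linear_combination 2 * h2

lemma mult_neg_mul_half (h : Regular α β d s) :
    mult α β (-d) s * (2 * ((half α β d s - d) * (half α β d s + d)))
      = α + β * s - 2 * d * s := by
  have h1 := h.sub_ne
  have h2 := half_sq (α := α) (β := β) (d := d) (s := s)
  rw [mult_neg]
  field_simp
  linear_combination 2 * h2

lemma one_sub_mul_half (h : Regular α β d s) :
    (1 - mult α β d s) * (1 - mult α β (-d) s)
      * (2 * ((half α β d s - d) * (half α β d s + d))) = 2 * s ^ 2 := by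
  have h1 := h.add_ne
  have h2 := h.sub_ne
  rw [mult_neg, mult]
  field_simp
  ring

lemma half_mul_ne_zero (h : Regular α β d s) :
    2 * ((half α β d s - d) * (half α β d s + d)) ≠ 0 :=
  mul_ne_zero two_ne_zero (mul_ne_zero h.sub_ne h.add_ne)

lemma ratio_mul (h : Regular α β d s) :
    ratio α β d s * (1 - mult α β (-d) s) = 1 - mult α β d s := by
  have h1 := h.add_ne
  have h2 := h.sub_ne
  rw [mult_neg, mult, ratio]
  field_simp
  ring

lemma invOneAdd_mul (h : Regular α β d s) :
    invOneAdd α β d s * (1 + mult α β (-d) s) = 1 := by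
  have h1 := h.sub_ne
  have h2 := h.rt_sub_ne
  have h3 : half α β d s = (rt α β d s + s) / 2 := rfl
  have h4 : (half α β d s - d) * (1 + (1 - s / (half α β d s - d))) = rt α β d s - 2 * d := by
    field_simp
    linear_combination 2 * h3
  rw [mult_neg, invOneAdd, div_mul_eq_mul_div, h4, div_self h2]

/-- The multiplier solves the characteristic equation. -/
lemma mult_char (h : Regular α β d s) :
    (α + β * s - 2 * d * s) * (mult α β d s) ^ 2 - 2 * (α + β * s + s ^ 2) * mult α β d s
      + (α + β * s + 2 * d * s) = 0 := by
  have h1 := h.add_ne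
  have h2 := half_sq (α := α) (β := β) (d := d) (s := s)
  rw [mult]
  field_simp
  linear_combination (-2 * s ^ 2) * h2

end Algebra

section Regularity

lemma Regular.differentiableAt_rt (h : Regular α β d s) : DifferentiableAt ℂ (rt α β d) s := by
  unfold rt
  refine DifferentiableAt.cpow ?_ (by fun_prop) h.slit
  unfold disc
  fun_prop

lemma Regular.differentiableAt_half (h : Regular α β d s) :
    DifferentiableAt ℂ (half α β d) s := by
  unfold half
  exact (h.differentiableAt_rt.add differentiableAt_id).div_const 2

lemma Regular.differentiableAt_mult (h : Regular α β d s) :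
    DifferentiableAt ℂ (mult α β d) s := by
  unfold mult
  exact (differentiableAt_const _).sub
    (differentiableAt_id.div (h.differentiableAt_half.add_const _) h.add_ne)

lemma Regular.differentiableAt_ratio (h : Regular α β d s) :
    DifferentiableAt ℂ (ratio α β d) s := by
  unfold ratio
  exact (h.differentiableAt_half.sub_const _).div (h.differentiableAt_half.add_const _) h.add_ne

lemma Regular.differentiableAt_invOneAdd (h : Regular α β d s) :
    DifferentiableAt ℂ (invOneAdd α β d) s := by
  unfold invOneAdd
  exact (h.differentiableAt_half.sub_const _).div (h.differentiableAt_rt.sub_const _) h.rt_sub_ne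

end Regularity

end Dispersion

/-! ### Bounds on a half plane and on the imaginary axis -/

namespace Dispersion

variable {α β d η : ℝ} {s : ℂ}

lemma exists_bound_of_far {S : Set ℂ} (hS : IsClosed S) {f : ℂ → ℂ} (hf : ContinuousOn f S)
    {R C : ℝ} (hC : ∀ s ∈ S, R ≤ ‖s‖ → ‖f s‖ ≤ C) : ∃ C', ∀ s ∈ S, ‖f s‖ ≤ C' := by
  obtain ⟨B, hB⟩ := ((isCompact_closedBall (0 : ℂ) R).inter_left hS).exists_bound_of_continuousOn
    (hf.mono inter_subset_left)
  refine ⟨max B C, fun s hs => ?_⟩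
  rcases le_or_gt R ‖s‖ with h | h
  · exact (hC s hs h).trans (le_max_right _ _)
  · exact (hB s ⟨hs, by simpa using h.le⟩).trans (le_max_left _ _)

lemma exists_bound_div {S : Set ℂ} (hS : IsClosed S) {f g : ℂ → ℂ} (hf : ContinuousOn f S)
    (hg : ContinuousOn g S) (h0 : ∀ s ∈ S, g s ≠ 0) {C : ℝ}
    (hfC : ∀ s ∈ S, ‖f s - s‖ ≤ C) (hgC : ∀ s ∈ S, ‖g s - s‖ ≤ C) :
    ∃ C', ∀ s ∈ S, ‖f s / g s‖ ≤ C' := by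
  -- For `‖s‖ ≥ 2 * C + 1` the quotient is at most `(‖s‖ + C) / (‖s‖ - C) ≤ 3`; the rest is
  -- compactness.
  refine exists_bound_of_far (R := 2 * C + 1) (C := 3) hS (hf.div hg h0) fun s hs hR => ?_
  have h1 : ‖f s‖ ≤ ‖s‖ + C := by
    have := norm_add_le (f s - s) s
    simp only [sub_add_cancel] at this
    linarith [hfC s hs]
  have h2 : ‖s‖ - C ≤ ‖g s‖ := by
    have := norm_sub_norm_le s (s - g s)
    simp only [sub_sub_cancel] at this
    linarith [hgC s hs, norm_sub_rev (g s) s]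
  have hC0 : 0 ≤ C := (norm_nonneg _).trans (hfC s hs)
  rw [norm_div, div_le_iff₀ (by linarith)]
  linarith

/-- Completing the square, `rt ^ 2 - (s + β) ^ 2` is constant, and the factor `rt + (s + β)` has
real part at least `β / 2`. -/
lemma exists_norm_rt_sub_le (hβ : 0 < β) (α d : ℝ) :
    ∃ C, ∀ s : ℂ, -(β / 2) ≤ s.re → ‖rt α β d s - s‖ ≤ C := by
  refine ⟨‖(2 * α + 4 * d ^ 2 - β ^ 2 : ℂ)‖ / (β / 2) + β, fun s hs => ?_⟩
  have h1 : (rt α β d s - (s + β)) * (rt α β d s + (s + β)) = 2 * α + 4 * d ^ 2 - β ^ 2 := by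
    have h4 := rt_sq (α := α) (β := β) (d := d) (s := s)
    rw [disc] at h4
    linear_combination h4
  have h2 : β / 2 ≤ ‖rt α β d s + (s + β)‖ := by
    refine le_trans ?_ (Complex.re_le_norm _)
    have := rt_re_nonneg (α := α) (β := β) (d := d) (s := s)
    simp
    linarith
  have h3 : ‖rt α β d s - (s + β)‖ ≤ ‖(2 * α + 4 * d ^ 2 - β ^ 2 : ℂ)‖ / (β / 2) := by
    rw [le_div_iff₀ (by positivity), ← h1, norm_mul]
    gcongr
  calc ‖rt α β d s - s‖ = ‖(rt α β d s - (s + β)) + β‖ := by congr 1; ring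
    _ ≤ _ := (norm_add_le _ _).trans (by simpa [abs_of_pos hβ] using h3)

lemma exists_norm_half_sub_le (hβ : 0 < β) (α d : ℝ) :
    ∃ C, ∀ s : ℂ, -(β / 2) ≤ s.re → ‖half α β d s - s‖ ≤ C := by
  obtain ⟨C, hC⟩ := exists_norm_rt_sub_le hβ α d
  refine ⟨C / 2, fun s hs => ?_⟩
  rw [show half α β d s - s = (rt α β d s - s) / 2 by rw [half]; ring, norm_div]
  simpa using div_le_div_of_nonneg_right (hC s hs) zero_le_two

lemma isClosed_halfPlane (η : ℝ) : IsClosed {s : ℂ | -η ≤ s.re} :=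
  isClosed_le continuous_const Complex.continuous_re

lemma exists_bound_mult (hβ : 0 < β) (hη : η ≤ β / 2)
    (hreg : ∀ s : ℂ, -η ≤ s.re → Regular α β d s) :
    ∃ C, ∀ s : ℂ, -η ≤ s.re → ‖mult α β d s‖ * ‖1 + s‖ ≤ C := by
  obtain ⟨C, hC⟩ := exists_norm_half_sub_le hβ α d
  have hC0 := (norm_nonneg _).trans (hC 0 (by simp; linarith))
  obtain ⟨B, hB⟩ := exists_bound_div (f := fun s => 1 + s) (g := fun s => half α β d s + d)
    (C := max 1 (C + |d|)) (isClosed_halfPlane η) (by fun_prop)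
    (fun s hs => ((hreg s hs).differentiableAt_half.continuousAt.add
      continuousAt_const).continuousWithinAt)
    (fun s hs => (hreg s hs).add_ne) (fun s hs => by simp)
    (fun s hs => by
      refine le_trans ?_ (le_max_right _ _)
      rw [show half α β d s + d - s = (half α β d s - s) + d by ring]
      refine (norm_add_le _ _).trans ?_
      have := hC s (by simp at hs; linarith)
      simpa using this)
  refine ⟨(C + |d|) * B, fun s hs => ?_⟩
  -- Both factors are bounded because `half - s` is; so the multiplier is `O(1 / ‖s‖)`.
  have h1 : mult α β d s * (1 + s) = (half α β d s - s + d) * ((1 + s) / (half α β d s + d)) := by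
    have := (hreg s hs).add_ne
    rw [mult]
    field_simp
    ring
  rw [← norm_mul, h1, norm_mul]
  have h2 : ‖half α β d s - s + d‖ ≤ C + |d| := by
    refine (norm_add_le _ _).trans ?_
    simpa using hC s (by linarith)
  have h3 := hB s hs
  gcongr

lemma exists_bound_ratio (hβ : 0 < β) (hη : η ≤ β / 2)
    (hreg : ∀ s : ℂ, -η ≤ s.re → Regular α β d s) :
    ∃ C, ∀ s : ℂ, -η ≤ s.re → ‖ratio α β d s‖ ≤ C := by
  obtain ⟨C, hC⟩ := exists_norm_half_sub_le hβ α d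
  refine exists_bound_div (f := fun s => half α β d s - d) (g := fun s => half α β d s + d)
    (C := C + |d|) (isClosed_halfPlane η)
    (fun s hs => ((hreg s hs).differentiableAt_half.continuousAt.sub
      continuousAt_const).continuousWithinAt)
    (fun s hs => ((hreg s hs).differentiableAt_half.continuousAt.add
      continuousAt_const).continuousWithinAt)
    (fun s hs => (hreg s hs).add_ne) (fun s hs => ?_) (fun s hs => ?_)
  · rw [show half α β d s - d - s = (half α β d s - s) - d by ring]
    refine (norm_sub_le _ _).trans ?_
    simpa using hC s (by simp at hs; linarith)
  · rw [show half α β d s + d - s = (half α β d s - s) + d by ring]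
    refine (norm_add_le _ _).trans ?_
    simpa using hC s (by simp at hs; linarith)

lemma exists_bound_invOneAdd (hβ : 0 < β) (hη : η ≤ β / 2)
    (hreg : ∀ s : ℂ, -η ≤ s.re → Regular α β d s) :
    ∃ C, ∀ s : ℂ, -η ≤ s.re → ‖invOneAdd α β d s‖ ≤ C := by
  obtain ⟨C, hC⟩ := exists_norm_half_sub_le hβ α d
  obtain ⟨C', hC'⟩ := exists_norm_rt_sub_le hβ α d
  refine exists_bound_div (f := fun s => half α β d s - d) (g := fun s => rt α β d s - 2 * d)
    (C := max (C + |d|) (C' + 2 * |d|)) (isClosed_halfPlane η)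
    (fun s hs => ((hreg s hs).differentiableAt_half.continuousAt.sub
      continuousAt_const).continuousWithinAt)
    (fun s hs => ((hreg s hs).differentiableAt_rt.continuousAt.sub
      continuousAt_const).continuousWithinAt)
    (fun s hs => (hreg s hs).rt_sub_ne) (fun s hs => ?_) (fun s hs => ?_)
  · rw [show half α β d s - d - s = (half α β d s - s) - d by ring]
    refine (norm_sub_le _ _).trans (le_trans ?_ (le_max_left _ _))
    simpa using hC s (by simp at hs; linarith)
  · rw [show rt α β d s - 2 * d - s = (rt α β d s - s) - 2 * d by ring]
    refine (norm_sub_le _ _).trans (le_trans ?_ (le_max_right _ _))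
    simpa using hC' s (by simp at hs; linarith)

/-- On the imaginary axis, away from the origin, the multiplier does not have modulus one. -/
lemma norm_mult_ne_one (hβ : 0 < β) {ω : ℝ} (hω : ω ≠ 0)
    (h : Regular α β d (ω * Complex.I)) : ‖mult α β d (ω * Complex.I)‖ ≠ 1 := by
  intro h1
  have hc := mult_char h
  have hM := one_sub_mul_half h
  have hx : mult α β d (ω * Complex.I) = 1 → False := by
    intro h2
    rw [h2] at hM
    simp [hω] at hM
  generalize mult α β d (ω * Complex.I) = u at *
  have hn : u.re ^ 2 + u.im ^ 2 = 1 := by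
    have := Complex.sq_norm u
    rw [h1, Complex.normSq_apply] at this
    linarith
  have hconj : u * (starRingEnd ℂ) u = 1 := by
    rw [Complex.mul_conj, Complex.normSq_apply]
    norm_cast
    linarith
  -- On the unit circle `1 / u` is the conjugate of `u`. The imaginary part of the characteristic
  -- equation divided by `u` reduces to `β * ω * (u.re - 1) = 0`, so `u = 1`, which
  -- `one_sub_mul_half` excludes for `s ≠ 0`.
  have h3 : (α + β * (ω * Complex.I) - 2 * d * (ω * Complex.I)) * u
      - 2 * (α + β * (ω * Complex.I) + (ω * Complex.I) ^ 2)
      + (α + β * (ω * Complex.I) + 2 * d * (ω * Complex.I)) * (starRingEnd ℂ) u = 0 := by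
    linear_combination (starRingEnd ℂ) u * hc
      - ((α + β * (ω * Complex.I) - 2 * d * (ω * Complex.I)) * u
      - 2 * (α + β * (ω * Complex.I) + (ω * Complex.I) ^ 2)) * hconj
  have h4 := congrArg Complex.im h3
  simp [pow_two] at h4
  have h5 : β * ω * (u.re - 1) = 0 := by linarith
  have h6 : u.re = 1 := by
    rcases mul_eq_zero.1 h5 with h | h
    · exact absurd h (by positivity)
    · linarith
  have h7 : u.im = 0 := by
    rw [h6] at hn
    simpa using hn
  exact hx (Complex.ext (by simpa using h6) (by simpa using h7))

/-- On the imaginary axis, away from the origin, the multiplier has modulus less than one. -/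
lemma norm_mult_lt_one (hβ : 0 < β) (hη0 : 0 < η) (hη : η ≤ β / 2)
    (hreg : ∀ s : ℂ, -η ≤ s.re → Regular α β d s) {ω : ℝ} (hω : ω ≠ 0) :
    ‖mult α β d (ω * Complex.I)‖ < 1 := by
  obtain ⟨C, hC⟩ := exists_bound_mult hβ hη hreg
  have hre : ∀ x : ℝ, Regular α β d (x * Complex.I) := fun x => hreg _ (by simp; exact hη0.le)
  have hcont : Continuous fun x : ℝ => ‖mult α β d (x * Complex.I)‖ := by
    refine continuous_norm.comp (continuous_iff_continuousAt.2 fun x => ?_)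
    exact ((hre x).differentiableAt_mult.continuousAt).comp
      (f := fun x : ℝ => (x * Complex.I : ℂ)) (by fun_prop)
  have hfar : ∀ x : ℝ, C < |x| → ‖mult α β d (x * Complex.I)‖ < 1 := by
    intro x hx
    have h1 := hC (x * Complex.I) (by simp; exact hη0.le)
    have h2 : |x| ≤ ‖1 + (x * Complex.I : ℂ)‖ := by
      simpa using Complex.abs_im_le_norm (1 + (x * Complex.I : ℂ))
    by_contra! h3
    nlinarith [norm_nonneg (1 + (x * Complex.I : ℂ))]
  by_contra! h
  -- A distant point on the same side of the origin as `ω`: the modulus is below one there and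
  -- cannot cross one in between.
  set y : ℝ := if 0 < ω then |C| + 1 + |ω| else -(|C| + 1 + |ω|) with hy
  have hyC : ‖mult α β d (y * Complex.I)‖ < 1 := by
    refine hfar y ?_
    have h1 : |y| = |C| + 1 + |ω| := by
      rw [hy]
      split_ifs
      · exact abs_of_pos (by positivity)
      · rw [abs_neg]; exact abs_of_pos (by positivity)
    rw [h1]
    linarith [le_abs_self C, abs_nonneg ω]
  have hmem : (1 : ℝ) ∈ (fun x : ℝ => ‖mult α β d (x * Complex.I)‖) '' uIcc ω y :=
    intermediate_value_uIcc hcont.continuousOn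
      (by rw [uIcc_of_ge (hyC.le.trans h)]; exact ⟨hyC.le, h⟩)
  obtain ⟨x, hx, hx1⟩ := hmem
  refine norm_mult_ne_one hβ ?_ (hre x) hx1
  rcases lt_or_gt_of_ne hω with h0 | h0
  · have : y = -(|C| + 1 + |ω|) := by rw [hy, if_neg h0.not_gt]
    rw [uIcc_of_ge (by rw [this]; linarith [neg_abs_le ω, abs_nonneg C])] at hx
    linarith [hx.2]
  · have : y = |C| + 1 + |ω| := by rw [hy, if_pos h0]
    rw [uIcc_of_le (by rw [this]; linarith [le_abs_self ω, abs_nonneg C])] at hx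
    linarith [hx.1]

end Dispersion

/-! ### Expansion at the origin and decay in a strip -/

namespace Dispersion

variable {α β d η : ℝ} {s : ℂ}

/-- The signal speed belonging to the multiplier `mult`. -/
noncomputable def speed (α d : ℝ) : ℝ := √(2 * α + 4 * d ^ 2) / 2 + d

lemma speed_pos (hα : 0 < α) : 0 < speed α d := by
  have h : |2 * d| < √(2 * α + 4 * d ^ 2) := by
    rw [← Real.sqrt_sq_eq_abs]
    exact Real.sqrt_lt_sqrt (by positivity) (by nlinarith)
  rw [speed]
  linarith [neg_abs_le (2 * d)]

lemma rt_zero (hα : 0 < α) : rt α β d 0 = (√(2 * α + 4 * d ^ 2) : ℝ) := by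
  have h0 : (0 : ℝ) ≤ 2 * α + 4 * d ^ 2 := by positivity
  rw [rt, disc, Real.sqrt_eq_rpow, Complex.ofReal_cpow h0]
  simp

lemma half_zero_add (hα : 0 < α) : half α β d 0 + d = (speed α d : ℝ) := by
  rw [half, rt_zero hα, speed]
  push_cast
  ring

lemma mult_zero : mult α β d 0 = 1 := by simp [mult]

lemma hasDerivAt_rt_zero (hα : 0 < α) (h : Regular α β d 0) :
    HasDerivAt (rt α β d) (β / (√(2 * α + 4 * d ^ 2) : ℝ)) 0 := by
  have h1 := h.differentiableAt_rt.hasDerivAt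
  have h2 := h1.pow 2
  have h3 : HasDerivAt (disc α β d) (2 * β) 0 := by
    unfold disc
    have := ((hasDerivAt_pow 2 (0 : ℂ)).add ((hasDerivAt_id (0 : ℂ)).const_mul (2 * β : ℂ))).add_const
      (2 * α + 4 * d ^ 2 : ℂ)
    convert! this using 1
    simp
  have h4 : HasDerivAt (disc α β d) _ 0 :=
    h2.congr_of_eventuallyEq (Eventually.of_forall fun x => by simp [rt_sq])
  have h5 := h3.unique h4
  have h6 : (√(2 * α + 4 * d ^ 2) : ℝ) ≠ 0 := by positivity
  have h7 : ((√(2 * α + 4 * d ^ 2) : ℝ) : ℂ) ≠ 0 := by exact_mod_cast h6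
  rw [rt_zero hα] at h5
  convert! h1 using 1
  field_simp
  norm_num at h5
  linear_combination h5 / 2

/-- Write `mult = 1 - s * v` with `v = 1 / c - q * s / c ^ 2 + o(s)`. In `‖1 - s * v‖ ^ 2 = 1 - 2 *
(s * v).re + ‖s * v‖ ^ 2` the coefficient of `s.im ^ 2` is `-(2 * q - 1) / c ^ 2`, negative since `2
* q - 1 = β / S`: the damping turns into spatial decay. -/
lemma exists_near_bound (hα : 0 < α) (hβ : 0 < β) (h : Regular α β d 0) :
    ∃ δ > 0, ∃ C κ : ℝ, 0 ≤ C ∧ 0 < κ ∧ ∀ s : ℂ, ‖s‖ ≤ δ →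
      ‖mult α β d s‖ ^ 2 * (1 + κ * s.im ^ 2)
        ≤ Real.exp (-2 * s.re / speed α d + C * s.re ^ 2) := by
  set S := √(2 * α + 4 * d ^ 2) with hS
  have hSpos : 0 < S := by positivity
  set c := speed α d with hc
  have hcpos : 0 < c := speed_pos hα
  set q : ℝ := (β / S + 1) / 2 with hq
  set κ : ℝ := (2 * q - 1) / c ^ 2 with hκ
  have hκpos : 0 < κ := by
    have : 2 * q - 1 = β / S := by rw [hq]; ring
    rw [hκ, this]
    positivity
  set v : ℂ → ℂ := fun s => (half α β d s + d)⁻¹ with hv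
  have hder : HasDerivAt v (-(q : ℂ) / (c : ℂ) ^ 2) 0 := by
    have h1 : HasDerivAt (fun s => half α β d s + d) (q : ℂ) 0 := by
      unfold half
      have := (((hasDerivAt_rt_zero hα h).add (hasDerivAt_id (0 : ℂ))).div_const 2).add_const (d : ℂ)
      convert! this using 1
      rw [hq]
      push_cast
      rfl
    have := h1.fun_inv h.add_ne
    rwa [half_zero_add hα] at this
  have hv0 : v 0 = (c : ℂ)⁻¹ := by simp only [hv]; rw [half_zero_add hα]
  have hA : ∀ᶠ s in 𝓝 (0 : ℂ), ‖v s - (c : ℂ)⁻¹ + q / c ^ 2 * s‖ ≤ κ / 6 * ‖s‖ := by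
    have := (hasDerivAt_iff_isLittleO.1 hder).bound (show (0 : ℝ) < κ / 6 by positivity)
    filter_upwards [this] with s hs
    rw [hv0, sub_zero, smul_eq_mul] at hs
    have e1 : v s - (c : ℂ)⁻¹ + q / c ^ 2 * s = v s - (c : ℂ)⁻¹ - s * (-(q : ℂ) / (c : ℂ) ^ 2) := by
      ring
    rw [e1]
    exact hs
  have hB : ∀ᶠ s in 𝓝 (0 : ℂ), ‖v s‖ ^ 2 < 1 / c ^ 2 + κ / 6 := by
    have : Tendsto (fun s => ‖v s‖ ^ 2) (𝓝 0) (𝓝 (‖v 0‖ ^ 2)) :=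
      (hder.continuousAt.norm.pow 2)
    refine this.eventually_lt_const ?_
    rw [hv0]
    simp [abs_of_pos hcpos]
    positivity
  obtain ⟨δ, hδ, hball⟩ := Metric.eventually_nhds_iff.1 (hA.and hB)
  -- The errors are `κ / 3 * ‖s‖ ^ 2` from `2 * (s * v).re` and `κ / 6 * ‖s‖ ^ 2` from `‖s * v‖ ^
  -- 2`; together they use up half of `κ`.
  refine ⟨δ / 2, by positivity, (2 * q + 1) / c ^ 2 + κ / 2, κ / 2, by positivity, by positivity,
    fun s hs => ?_⟩
  obtain ⟨h1, h2⟩ := hball (show dist s 0 < δ by rw [dist_zero_right]; linarith)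
  have hsq : ‖s‖ ^ 2 = s.re ^ 2 + s.im ^ 2 := by
    rw [Complex.sq_norm, Complex.normSq_apply]; ring
  set e := v s - (c : ℂ)⁻¹ + q / c ^ 2 * s with he
  have hm : mult α β d s = 1 - s * v s := by rw [mult, hv, div_eq_mul_inv]
  have hse : |(s * e).re| ≤ κ / 6 * ‖s‖ ^ 2 := by
    refine (Complex.abs_re_le_norm _).trans ?_
    rw [norm_mul]
    nlinarith [norm_nonneg s]
  have hre : (s * v s).re = s.re / c - q / c ^ 2 * (s.re ^ 2 - s.im ^ 2) + (s * e).re := by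
    have : s * v s = s * ((c⁻¹ : ℝ) : ℂ) - ((q / c ^ 2 : ℝ) : ℂ) * s ^ 2 + s * e := by
      rw [he]; push_cast; ring
    rw [this, Complex.add_re, Complex.sub_re, Complex.re_mul_ofReal, Complex.re_ofReal_mul,
      pow_two s, Complex.mul_re]
    ring
  have hsv : ‖s * v s‖ ^ 2 ≤ (1 / c ^ 2 + κ / 6) * ‖s‖ ^ 2 := by
    rw [norm_mul, mul_pow]
    nlinarith [sq_nonneg ‖s‖]
  have hexp : ‖1 - s * v s‖ ^ 2 = 1 - 2 * (s * v s).re + ‖s * v s‖ ^ 2 := by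
    simp only [Complex.sq_norm, Complex.normSq_apply, Complex.sub_re, Complex.sub_im,
      Complex.one_re, Complex.one_im]
    ring
  have hκ' : κ = 2 * (q / c ^ 2) - 1 / c ^ 2 := by rw [hκ]; ring
  have hmain : ‖mult α β d s‖ ^ 2 ≤ 1 + ((-2 * s.re / c + ((2 * q + 1) / c ^ 2 + κ / 2) * s.re ^ 2)
      - κ / 2 * s.im ^ 2) := by
    rw [hm, hexp, hre]
    have h5 := (abs_le.1 hse).1
    rw [hsq] at h5 hsv
    have h6 : (2 * q + 1) / c ^ 2 = 2 * (q / c ^ 2) + 1 / c ^ 2 := by ring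
    have h7 : -2 * s.re / c = -2 * (s.re / c) := by ring
    rw [h6, h7]
    have h8 : (κ / 2) * s.im ^ 2 = κ * s.im ^ 2 - κ / 2 * s.im ^ 2 := by ring
    have h9 : κ * s.im ^ 2 = (2 * (q / c ^ 2) - 1 / c ^ 2) * s.im ^ 2 := by rw [← hκ']
    nlinarith [h5, hsv]
  set A := -2 * s.re / c + ((2 * q + 1) / c ^ 2 + κ / 2) * s.re ^ 2
  have hE : ‖mult α β d s‖ ^ 2 ≤ Real.exp (A - κ / 2 * s.im ^ 2) := by
    refine hmain.trans ?_
    linarith [Real.add_one_le_exp (A - κ / 2 * s.im ^ 2)]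
  have hE2 : 1 + κ / 2 * s.im ^ 2 ≤ Real.exp (κ / 2 * s.im ^ 2) := by
    linarith [Real.add_one_le_exp (κ / 2 * s.im ^ 2)]
  calc ‖mult α β d s‖ ^ 2 * (1 + κ / 2 * s.im ^ 2)
      ≤ Real.exp (A - κ / 2 * s.im ^ 2) * Real.exp (κ / 2 * s.im ^ 2) := by
        gcongr
    _ = Real.exp A := by rw [← Real.exp_add]; congr 1; ring

/-- A bound for the multiplier in a strip around the imaginary axis. -/
lemma exists_strip_bound (hα : 0 < α) (hβ : 0 < β) (hη0 : 0 < η) (hη : η ≤ β / 2)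
    (hreg : ∀ s : ℂ, -η ≤ s.re → Regular α β d s) :
    ∃ σ > 0, ∃ C κ : ℝ, 0 ≤ C ∧ 0 < κ ∧ ∀ s : ℂ, |s.re| ≤ σ →
      ‖mult α β d s‖ ^ 2 * (1 + κ * s.im ^ 2)
        ≤ Real.exp (-2 * s.re / speed α d + C * s.re ^ 2) := by
  obtain ⟨δ, hδ, C, κ₁, hC0, hκ₁, hnear⟩ :=
    exists_near_bound hα hβ (hreg 0 (by simpa using hη0.le))
  obtain ⟨B, hB⟩ := exists_bound_mult hβ hη hreg
  have hB0 : 0 ≤ B := (mul_nonneg (norm_nonneg _) (norm_nonneg _)).trans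
    (hB 0 (by simpa using hη0.le))
  set c := speed α d with hc
  have hcpos : 0 < c := speed_pos hα
  -- Beyond height `R` the bound `B / ‖1 + s‖` makes the multiplier at most `1 / 2`.
  set R : ℝ := 2 * B + δ + 1 with hR
  -- the part of the imaginary axis of moderate modulus
  have hU : IsOpen {s : ℂ | -η < s.re} := isOpen_lt continuous_const Complex.continuous_re
  have hcontU : ContinuousOn (fun s => ‖mult α β d s‖) {s : ℂ | -η < s.re} := fun s hs =>
    ((hreg s (le_of_lt hs)).differentiableAt_mult.continuousAt.norm).continuousWithinAt
  set T : Set ℂ := (fun x : ℝ => (x * Complex.I : ℂ)) '' (Icc (-R) R ∩ {x | δ / 2 ≤ |x|}) with hT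
  have hTc : IsCompact T :=
    (isCompact_Icc.inter_right (isClosed_le continuous_const continuous_abs)).image
      (by fun_prop)
  -- Compactness gives a uniform gap below one; being strict, it persists in a thin neighbourhood of
  -- `T`.
  obtain ⟨ρ, hρ0, hρ1, hρ⟩ : ∃ ρ : ℝ, 0 < ρ ∧ ρ < 1 ∧ ∀ s ∈ T, ‖mult α β d s‖ < ρ := by
    have hTne : T.Nonempty := by
      refine ⟨_, mem_image_of_mem _ (show R ∈ _ from ⟨⟨by linarith, le_rfl⟩, ?_⟩)⟩
      simp only [mem_ofPred_eq]
      rw [abs_of_pos (by linarith)]; linarith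
    obtain ⟨s₀, hs₀, hmax⟩ := hTc.exists_isMaxOn hTne (hcontU.mono (by
      rintro _ ⟨x, -, rfl⟩
      simpa using hη0))
    have hlt : ‖mult α β d s₀‖ < 1 := by
      obtain ⟨x, hx, rfl⟩ := hs₀
      refine norm_mult_lt_one hβ hη0 hη hreg ?_
      rintro rfl
      have := hx.2
      simp only [mem_ofPred_eq, abs_zero] at this
      linarith
    obtain ⟨ρ, h1, h2⟩ := exists_between hlt
    exact ⟨ρ, (norm_nonneg _).trans_lt h1, h2, fun s hs => (hmax hs).trans_lt h1⟩
  have hopen : IsOpen ({s : ℂ | -η < s.re} ∩ (fun s => ‖mult α β d s‖) ⁻¹' Iio ρ) :=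
    hcontU.isOpen_inter_preimage hU isOpen_Iio
  obtain ⟨τ, hτ, hthick⟩ := hTc.exists_thickening_subset_open hopen (by
    rintro _ ⟨x, hx, rfl⟩
    exact ⟨by simpa using hη0, hρ _ ⟨x, hx, rfl⟩⟩)
  -- choice of the constants
  obtain ⟨κ₂, hκ₂, hκ₂R, hκ₂B⟩ : ∃ κ₂ : ℝ, 0 < κ₂ ∧ ρ ^ 2 * (1 + κ₂ * R ^ 2) ≤ (ρ ^ 2 + 1) / 2 ∧
      κ₂ * B ^ 2 ≤ 1 / 4 := by
    have hρ2 : ρ ^ 2 < 1 := by nlinarith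
    have hRpos : 0 < R := by linarith
    refine ⟨min ((1 - ρ ^ 2) / (2 * ρ ^ 2 * R ^ 2)) (1 / (4 * (B ^ 2 + 1))),
      lt_min (div_pos (by linarith) (by positivity)) (by positivity), ?_, ?_⟩
    · have : min ((1 - ρ ^ 2) / (2 * ρ ^ 2 * R ^ 2)) (1 / (4 * (B ^ 2 + 1)))
        ≤ (1 - ρ ^ 2) / (2 * ρ ^ 2 * R ^ 2) := min_le_left _ _
      rw [le_div_iff₀ (by positivity)] at this
      linarith
    · have : min ((1 - ρ ^ 2) / (2 * ρ ^ 2 * R ^ 2)) (1 / (4 * (B ^ 2 + 1)))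
        ≤ 1 / (4 * (B ^ 2 + 1)) := min_le_right _ _
      rw [le_div_iff₀ (by positivity)] at this
      have h0 : 0 < min ((1 - ρ ^ 2) / (2 * ρ ^ 2 * R ^ 2)) (1 / (4 * (B ^ 2 + 1))) :=
        lt_min (div_pos (by linarith) (by positivity)) (by positivity)
      nlinarith
  -- Away from the origin `ρ'` bounds the left side of the claim; the strip is then taken so narrow
  -- that the exponential on the right is at least `ρ'`.
  set ρ' : ℝ := max ((ρ ^ 2 + 1) / 2) (1 / 2) with hρ'
  have hρ'1 : ρ' < 1 := max_lt (by nlinarith) (by norm_num)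
  have hρ'0 : 0 < ρ' := lt_max_of_lt_right (by norm_num)
  obtain ⟨σ₀, hσ₀, hσ₀ρ⟩ : ∃ σ₀ > 0, ρ' ≤ Real.exp (-2 * σ₀ / c) := by
    refine ⟨-Real.log ρ' * c / 2, ?_, ?_⟩
    · have := Real.log_neg hρ'0 hρ'1
      have : 0 < -Real.log ρ' := by linarith
      positivity
    · rw [show -2 * (-Real.log ρ' * c / 2) / c = Real.log ρ' by field_simp, Real.exp_log hρ'0]
  refine ⟨min (min σ₀ (δ / 2)) (min (τ / 2) η), by positivity, C, min κ₁ κ₂, hC0,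
    lt_min hκ₁ hκ₂, fun s hs => ?_⟩
  have hsσ : |s.re| ≤ σ₀ := hs.trans ((min_le_left _ _).trans (min_le_left _ _))
  have hsδ : |s.re| ≤ δ / 2 := hs.trans ((min_le_left _ _).trans (min_le_right _ _))
  have hsτ : |s.re| ≤ τ / 2 := hs.trans ((min_le_right _ _).trans (min_le_left _ _))
  have hsη : |s.re| ≤ η := hs.trans ((min_le_right _ _).trans (min_le_right _ _))
  rcases lt_or_ge |s.im| (δ / 2) with him | him
  · have hns : ‖s‖ ≤ δ := (Complex.norm_le_abs_re_add_abs_im s).trans (by linarith)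
    refine le_trans ?_ (hnear s hns)
    gcongr
    exact min_le_left _ _
  · have hexp : ρ' ≤ Real.exp (-2 * s.re / c + C * s.re ^ 2) := by
      refine hσ₀ρ.trans (Real.exp_le_exp.2 ?_)
      have : -2 * σ₀ / c ≤ -2 * s.re / c := by
        gcongr ?_ / c
        linarith [le_abs_self s.re]
      nlinarith [sq_nonneg s.re, mul_nonneg hC0 (sq_nonneg s.re)]
    refine le_trans ?_ hexp
    have hk : ‖mult α β d s‖ ^ 2 * (1 + min κ₁ κ₂ * s.im ^ 2)
        ≤ ‖mult α β d s‖ ^ 2 * (1 + κ₂ * s.im ^ 2) := by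
      gcongr
      exact min_le_right _ _
    refine hk.trans ?_
    rcases le_or_gt |s.im| R with hR1 | hR1
    · have hmem : s ∈ Metric.thickening τ T := by
        rw [Metric.mem_thickening_iff]
        refine ⟨s.im * Complex.I, ⟨s.im, ⟨abs_le.1 hR1, him⟩, rfl⟩, ?_⟩
        rw [dist_eq_norm]
        have : s - s.im * Complex.I = (s.re : ℂ) := by
          linear_combination -Complex.re_add_im s
        rw [this, Complex.norm_real, Real.norm_eq_abs]
        linarith
      have hm : ‖mult α β d s‖ < ρ := (hthick hmem).2
      refine le_trans ?_ (hκ₂R.trans (le_max_left _ _))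
      have : s.im ^ 2 ≤ R ^ 2 := by
        rw [← sq_abs]; gcongr
      gcongr
    · have hb := hB s (by linarith [neg_abs_le s.re])
      have h1 : |s.im| ≤ ‖1 + s‖ := by simpa using Complex.abs_im_le_norm (1 + s)
      have h2 : ‖mult α β d s‖ * |s.im| ≤ B :=
        (mul_le_mul_of_nonneg_left h1 (norm_nonneg _)).trans hb
      have h3 : ‖mult α β d s‖ ^ 2 * s.im ^ 2 ≤ B ^ 2 := by
        rw [← sq_abs s.im, ← mul_pow]
        gcongr
      have h4 : ‖mult α β d s‖ ≤ 1 / 2 := by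
        by_contra! h5
        nlinarith
      refine le_trans ?_ (le_max_right _ _)
      have h6 : ‖mult α β d s‖ ^ 2 ≤ 1 / 4 := by
        have := pow_le_pow_left₀ (norm_nonneg _) h4 2
        linarith
      have h7 := mul_le_mul_of_nonneg_left h3 hκ₂.le
      linarith

end Dispersion

namespace Dispersion

variable {α β d η : ℝ} {s : ℂ}

/-- Taking the square root of the `n`-th power of the strip bound leaves a factor `1 + κ * n * s.im
^ 2 / 2`, whose reciprocal has an integral of order `1 / √n`. -/
lemma sq_one_add_le_pow {x : ℝ} (hx : 0 ≤ x) {n : ℕ} (hn : 2 ≤ n) :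
    (1 + n * x / 2) ^ 2 ≤ (1 + x) ^ n := by
  induction n, hn using Nat.le_induction with
  | base => norm_num
  | succ n hn ih =>
    have hn' : (2 : ℝ) ≤ n := by exact_mod_cast hn
    calc (1 + ((n + 1 : ℕ) : ℝ) * x / 2) ^ 2 ≤ (1 + n * x / 2) ^ 2 * (1 + x) := by
          push_cast
          have h1 : 0 ≤ x ^ 2 * (n / 2 - 1 / 4) := mul_nonneg (sq_nonneg x) (by linarith)
          have h2 : 0 ≤ (n : ℝ) ^ 2 * x ^ 3 := by positivity
          nlinarith
      _ ≤ (1 + x) ^ n * (1 + x) := by gcongr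
      _ = (1 + x) ^ (n + 1) := (pow_succ _ _).symm

/-- Powers of the multiplier near the imaginary axis. -/
lemma exists_pow_bound (hα : 0 < α) (hβ : 0 < β) (hη0 : 0 < η) (hη : η ≤ β / 2)
    (hreg : ∀ s : ℂ, -η ≤ s.re → Regular α β d s) :
    ∃ σ > 0, ∃ C κ : ℝ, 0 < C ∧ 0 < κ ∧ ∀ n : ℕ, 2 ≤ n → ∀ s : ℂ, |s.re| ≤ σ →
      n * s.re ^ 2 ≤ 1 →
      ‖mult α β d s‖ ^ n * (1 + κ * n * s.im ^ 2) ≤ C * Real.exp (-(n * s.re / speed α d)) := by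
  obtain ⟨σ, hσ, C, κ, hC, hκ, h⟩ := exists_strip_bound hα hβ hη0 hη hreg
  refine ⟨σ, hσ, Real.exp (C / 2), κ / 2, Real.exp_pos _, by positivity, fun n hn s hs hns => ?_⟩
  have h1 := pow_le_pow_left₀ (by positivity) (h s hs) n
  rw [mul_pow] at h1
  have h2 := sq_one_add_le_pow (show 0 ≤ κ * s.im ^ 2 by positivity) hn
  have h3 : (‖mult α β d s‖ ^ n * (1 + κ / 2 * n * s.im ^ 2)) ^ 2
      ≤ (Real.exp (C / 2) * Real.exp (-(n * s.re / speed α d))) ^ 2 := by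
    calc (‖mult α β d s‖ ^ n * (1 + κ / 2 * n * s.im ^ 2)) ^ 2
        = (‖mult α β d s‖ ^ 2) ^ n * (1 + n * (κ * s.im ^ 2) / 2) ^ 2 := by ring
      _ ≤ (‖mult α β d s‖ ^ 2) ^ n * (1 + κ * s.im ^ 2) ^ n := by gcongr
      _ ≤ _ := h1
      _ = Real.exp (n * (-2 * s.re / speed α d + C * s.re ^ 2)) := by rw [Real.exp_nat_mul]
      _ ≤ Real.exp (2 * (C / 2 + -(n * s.re / speed α d))) := by
          refine Real.exp_le_exp.2 ?_
          have : C * (n * s.re ^ 2) ≤ C * 1 := by gcongr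
          have e : n * (-2 * s.re / speed α d + C * s.re ^ 2)
            = -2 * (n * s.re / speed α d) + C * (n * s.re ^ 2) := by ring
          rw [e]
          linarith
      _ = _ := by
          rw [← Real.exp_add, ← Real.exp_nat_mul]
          norm_num
  exact le_of_sq_le_sq h3 (by positivity)

end Dispersion

/-! ### Inverse Laplace transforms along vertical lines -/

section VerticalLines

open Complex

/-- The point on the vertical line through `σ` with frequency `ξ`. -/
noncomputable def linePoint (σ ξ : ℝ) : ℂ := σ + 2 * Real.pi * ξ * I

@[simp] lemma linePoint_re (σ ξ : ℝ) : (linePoint σ ξ).re = σ := by simp [linePoint]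

@[simp] lemma linePoint_im (σ ξ : ℝ) : (linePoint σ ξ).im = 2 * Real.pi * ξ := by simp [linePoint]

lemma continuous_linePoint (σ : ℝ) : Continuous (linePoint σ) := by
  unfold linePoint; fun_prop

/-- The inverse Laplace transform along the vertical line through `σ`. -/
noncomputable def invLaplace (F : ℂ → ℂ) (σ t : ℝ) : ℂ :=
  ∫ ξ : ℝ, exp (linePoint σ ξ * t) * F (linePoint σ ξ)

/-- `F` is holomorphic on the strip `a ≤ Re s ≤ b` and decays there like `|s|⁻⁴`. -/
structure StripDecay (F : ℂ → ℂ) (a b : ℝ) : Prop where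
  diff : ∀ s : ℂ, a ≤ s.re → s.re ≤ b → DifferentiableAt ℂ F s
  decay : ∃ C, ∀ s : ℂ, a ≤ s.re → s.re ≤ b → ‖F s‖ * (1 + s.im ^ 2) ^ 2 ≤ C

lemma norm_exp_linePoint (σ ξ t : ℝ) : ‖exp (linePoint σ ξ * t)‖ = Real.exp (σ * t) := by
  rw [norm_exp]; simp

/-- The factor `2 * π` in `linePoint` matches the normalization of the Fourier transform, so no
constant appears. -/
lemma invLaplace_eq_fourierInv (F : ℂ → ℂ) (σ t : ℝ) :
    invLaplace F σ t = exp (σ * t) * FourierTransform.fourierInv (fun ξ => F (linePoint σ ξ)) t := by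
  rw [Real.fourierInv_eq', invLaplace, ← integral_const_mul]
  congr 1
  ext ξ
  rw [smul_eq_mul, ← mul_assoc, ← Complex.exp_add]
  congr 2
  simp [linePoint]
  ring

variable {F : ℂ → ℂ} {a b σ : ℝ}

lemma integrable_inv_one_add_mul_sq {κ : ℝ} (hκ : 0 < κ) :
    Integrable fun x : ℝ => (1 + κ * x ^ 2)⁻¹ := by
  have := (integrable_inv_one_add_sq).comp_mul_left' (R := √κ) (by positivity)
  convert this using 3
  rw [mul_pow, Real.sq_sqrt hκ.le]

lemma integral_inv_one_add_mul_sq {κ : ℝ} (hκ : 0 < κ) :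
    ∫ x : ℝ, (1 + κ * x ^ 2)⁻¹ = Real.pi / √κ := by
  have h := Measure.integral_comp_mul_left (fun x : ℝ => (1 + x ^ 2)⁻¹) √κ
  rw [integral_univ_inv_one_add_sq, abs_of_pos (by positivity), smul_eq_mul] at h
  rw [div_eq_inv_mul, ← h]
  congr 1
  ext x
  rw [mul_pow, Real.sq_sqrt hκ.le]

/-- An estimate for the inverse Laplace transform by the size of the transform. -/
lemma norm_invLaplace_le {κ B : ℝ} (hκ : 0 < κ)
    (hB : ∀ s : ℂ, s.re = σ → ‖F s‖ * (1 + κ * s.im ^ 2) ≤ B) (t : ℝ) :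
    ‖invLaplace F σ t‖ ≤ Real.exp (σ * t) * (B / √κ) := by
  have hκ' : 0 < κ * (2 * Real.pi) ^ 2 := by positivity
  have h0 : 0 ≤ B := le_trans (by positivity) (hB (linePoint σ 0) (by simp))
  calc ‖invLaplace F σ t‖
      ≤ ∫ ξ : ℝ, Real.exp (σ * t) * B * (1 + κ * (2 * Real.pi) ^ 2 * ξ ^ 2)⁻¹ := by
        refine norm_integral_le_of_norm_le ((integrable_inv_one_add_mul_sq hκ').const_mul _)
          (Eventually.of_forall fun ξ => ?_)
        rw [norm_mul, norm_exp_linePoint, mul_assoc]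
        gcongr
        rw [← div_eq_mul_inv, le_div_iff₀ (by positivity)]
        have := hB (linePoint σ ξ) (by simp)
        rw [linePoint_im, mul_pow, ← mul_assoc] at this
        exact this
    _ = Real.exp (σ * t) * B * (Real.pi / (√κ * (2 * Real.pi))) := by
        rw [integral_const_mul, integral_inv_one_add_mul_sq hκ', Real.sqrt_mul hκ.le,
          Real.sqrt_sq (by positivity)]
    _ ≤ Real.exp (σ * t) * (B / √κ) := by
        rw [mul_assoc]
        gcongr
        have : B * (Real.pi / (√κ * (2 * Real.pi))) = B / √κ / 2 := by
          have := Real.pi_pos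
          field_simp
        rw [this]
        have : 0 ≤ B / √κ := by positivity
        linarith

namespace StripDecay

lemma continuous_line (h : StripDecay F a b) (ha : a ≤ σ) (hb : σ ≤ b) :
    Continuous fun ξ : ℝ => F (linePoint σ ξ) :=
  continuous_iff_continuousAt.2 fun ξ =>
    ((h.diff _ (by simpa) (by simpa)).continuousAt).comp (continuous_linePoint σ).continuousAt

lemma integrable_line (h : StripDecay F a b) (ha : a ≤ σ) (hb : σ ≤ b) :
    Integrable fun ξ : ℝ => F (linePoint σ ξ) := by
  obtain ⟨C, hC⟩ := h.decay
  refine ((integrable_inv_one_add_mul_sq (κ := (2 * Real.pi) ^ 2) (by positivity)).const_mul C).mono'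
    (h.continuous_line ha hb).aestronglyMeasurable (Eventually.of_forall fun ξ => ?_)
  have h1 := hC (linePoint σ ξ) (by simpa) (by simpa)
  rw [linePoint_im, mul_pow] at h1
  rw [← div_eq_mul_inv, le_div_iff₀ (by positivity)]
  refine le_trans ?_ h1
  gcongr
  have : 0 ≤ (2 * Real.pi) ^ 2 * ξ ^ 2 := by positivity
  nlinarith

/-- Decay faster than `|s|⁻²` is needed here: integrability of `ξ • F` makes the inverse transform
differentiable, as unit pulses have to be. -/
lemma integrable_mul_line (h : StripDecay F a b) (ha : a ≤ σ) (hb : σ ≤ b) :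
    Integrable fun ξ : ℝ => ξ • F (linePoint σ ξ) := by
  obtain ⟨C, hC⟩ := h.decay
  refine ((integrable_inv_one_add_mul_sq (κ := (2 * Real.pi) ^ 2) (by positivity)).const_mul C).mono'
    (continuous_id.smul (h.continuous_line ha hb)).aestronglyMeasurable
    (Eventually.of_forall fun ξ => ?_)
  have h1 := hC (linePoint σ ξ) (by simpa) (by simpa)
  rw [linePoint_im, mul_pow] at h1
  rw [← div_eq_mul_inv, le_div_iff₀ (by positivity), norm_smul]
  refine le_trans ?_ h1
  have h2 : ‖ξ‖ ≤ 1 + (2 * Real.pi) ^ 2 * ξ ^ 2 := by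
    rw [Real.norm_eq_abs, ← sq_abs ξ]
    have : (1 : ℝ) ≤ (2 * Real.pi) ^ 2 := by nlinarith [Real.pi_gt_three]
    nlinarith [sq_nonneg (|ξ| - 1), sq_nonneg (|ξ|), abs_nonneg ξ]
  calc ‖ξ‖ * ‖F (linePoint σ ξ)‖ * (1 + (2 * Real.pi) ^ 2 * ξ ^ 2)
      = ‖F (linePoint σ ξ)‖ * (‖ξ‖ * (1 + (2 * Real.pi) ^ 2 * ξ ^ 2)) := by ring
    _ ≤ ‖F (linePoint σ ξ)‖ * ((1 + (2 * Real.pi) ^ 2 * ξ ^ 2) * (1 + (2 * Real.pi) ^ 2 * ξ ^ 2)) := by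
        gcongr
    _ = _ := by ring

lemma integrable_exp_line (h : StripDecay F a b) (ha : a ≤ σ) (hb : σ ≤ b) (t : ℝ) :
    Integrable fun ξ : ℝ => exp (linePoint σ ξ * t) * F (linePoint σ ξ) := by
  refine (h.integrable_line ha hb).bdd_mul (c := Real.exp (σ * t))
    (Continuous.aestronglyMeasurable ?_) (Eventually.of_forall fun ξ => ?_)
  · have := continuous_linePoint σ
    fun_prop
  · rw [norm_exp_linePoint]

lemma differentiable_invLaplace (h : StripDecay F a b) (ha : a ≤ σ) (hb : σ ≤ b) :
    Differentiable ℝ (invLaplace F σ) := by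
  have h1 : Differentiable ℝ (FourierTransform.fourier fun ξ => F (linePoint σ ξ)) := fun t =>
    (Real.hasDerivAt_fourier (h.integrable_line ha hb)
      (h.integrable_mul_line ha hb) t).differentiableAt
  have h2 : invLaplace F σ = fun t : ℝ =>
      exp (σ * t) * FourierTransform.fourier (fun ξ => F (linePoint σ ξ)) (-t) := by
    ext t
    rw [invLaplace_eq_fourierInv, Real.fourierInv_eq_fourier_neg]
  rw [h2]
  refine Differentiable.mul ?_ (h1.comp differentiable_neg)
  intro t
  have : HasDerivAt (fun z : ℂ => exp (σ * z)) _ (t : ℂ) :=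
    ((hasDerivAt_id (t : ℂ)).const_mul (σ : ℂ)).cexp
  exact this.comp_ofReal.differentiableAt

/-- The total integral of an inverse Laplace transform. -/
lemma integral_invLaplace_zero (h : StripDecay F a b) (ha : a ≤ 0) (hb : 0 ≤ b)
    (hint : Integrable (invLaplace F 0)) : ∫ t, invLaplace F 0 t = F 0 := by
  have h1 : invLaplace F 0 = FourierTransform.fourierInv fun ξ => F (linePoint 0 ξ) := by
    ext t
    simp [invLaplace_eq_fourierInv]
  rw [h1] at hint ⊢
  have h2 : Integrable (FourierTransform.fourier fun ξ => F (linePoint 0 ξ)) := by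
    have := hint.comp_neg
    convert this using 1
    ext t
    simp [Real.fourierInv_eq_fourier_neg]
  have h3 := (h.continuous_line ha hb).fourier_fourierInv_eq (h.integrable_line ha hb) h2
  have h4 := congrFun h3 0
  rw [Real.fourier_eq] at h4
  simpa [linePoint] using h4

/-- The inverse Laplace transform does not depend on the vertical line. -/
lemma invLaplace_eq (h : StripDecay F a b) (hab : a ≤ b) (t : ℝ) :
    invLaplace F a t = invLaplace F b t := by
  set G : ℂ → ℂ := fun s => exp (s * t) * F s with hG
  have hscale : ∀ σ, invLaplace F σ t = ((2 * Real.pi)⁻¹ : ℝ) • ∫ y : ℝ, G (σ + y * I) := by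
    intro σ
    have := Measure.integral_comp_mul_left (fun y : ℝ => G (σ + y * I)) (2 * Real.pi)
    rw [abs_of_pos (by positivity)] at this
    rw [← this, invLaplace]
    congr 1
    ext ξ
    simp only [hG, linePoint]
    push_cast
    rfl
  have hint : ∀ σ, a ≤ σ → σ ≤ b → Integrable fun y : ℝ => G (σ + y * I) := by
    intro σ ha hb
    have h1 := h.integrable_exp_line ha hb t
    have h2 := h1.comp_mul_left' (R := (2 * Real.pi)⁻¹) (by positivity)
    have h3 : ∀ y : ℝ, linePoint σ ((2 * Real.pi)⁻¹ * y) = σ + y * I := by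
      intro y
      have : (Real.pi : ℂ) ≠ 0 := by exact_mod_cast Real.pi_ne_zero
      simp only [linePoint]
      push_cast
      field_simp
    simpa only [h3] using h2
  obtain ⟨C, hC⟩ := h.decay
  set E := Real.exp (max |a * t| |b * t|) with hE
  have hre : ∀ x : ℝ, x ∈ uIcc a b → Real.exp (x * t) ≤ E := by
    intro x hx
    rw [uIcc_of_le hab] at hx
    refine Real.exp_le_exp.2 ?_
    rcases le_total 0 t with ht | ht
    · exact ((mul_le_mul_of_nonneg_right hx.2 ht).trans (le_abs_self _)).trans (le_max_right _ _)
    · exact ((mul_le_mul_of_nonpos_right hx.1 ht).trans (le_abs_self _)).trans (le_max_left _ _)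
  -- Cauchy's theorem on the rectangle of height `2 * T`: its horizontal sides contribute nothing in
  -- the limit.
  have hhor : ∀ T : ℝ, ‖∫ x : ℝ in a..b, G (x + T * I)‖ ≤ E * C * (1 + T ^ 2)⁻¹ * |b - a| := by
    intro T
    refine intervalIntegral.norm_integral_le_of_norm_le_const fun x hx => ?_
    have hx' : x ∈ uIcc a b := uIoc_subset_uIcc hx
    have hx2 := hx'
    rw [uIcc_of_le hab] at hx2
    rw [hG, norm_mul, norm_exp, mul_assoc]
    have h1 := hC (x + T * I) (by simpa using hx2.1) (by simpa using hx2.2)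
    have h2 : ((x : ℂ) + T * I).im = T := by simp
    rw [h2] at h1
    gcongr
    · simpa using hre x hx'
    · rw [← div_eq_mul_inv, le_div_iff₀ (by positivity)]
      refine le_trans ?_ h1
      gcongr
      nlinarith [sq_nonneg T]
  have hlim0 : Tendsto (fun T : ℝ => E * C * (1 + T ^ 2)⁻¹ * |b - a|) atTop (𝓝 0) := by
    have : Tendsto (fun T : ℝ => (1 + T ^ 2)⁻¹) atTop (𝓝 0) :=
      tendsto_inv_atTop_zero.comp
        (tendsto_atTop_add_const_left _ _ (tendsto_pow_atTop two_ne_zero))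
    simpa using (this.const_mul (E * C)).mul_const |b - a|
  have htop : Tendsto (fun T : ℝ => ∫ x : ℝ in a..b, G (x + T * I)) atTop (𝓝 0) :=
    squeeze_zero_norm hhor hlim0
  have hbot : Tendsto (fun T : ℝ => ∫ x : ℝ in a..b, G (x + ((-T : ℝ) : ℂ) * I)) atTop (𝓝 0) :=
    squeeze_zero_norm (fun T => by simpa using hhor (-T)) hlim0
  have hA := intervalIntegral_tendsto_integral (hint a le_rfl hab) tendsto_neg_atTop_atBot
    (tendsto_id (x := atTop))
  have hB := intervalIntegral_tendsto_integral (hint b hab le_rfl) tendsto_neg_atTop_atBot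
    (tendsto_id (x := atTop))
  have hrect : ∀ T : ℝ, (∫ x : ℝ in a..b, G (x + ((-T : ℝ) : ℂ) * I))
      - (∫ x : ℝ in a..b, G (x + T * I))
      + I • ((∫ y : ℝ in (-T)..T, G (b + y * I)) - ∫ y : ℝ in (-T)..T, G (a + y * I)) = 0 := by
    intro T
    have := integral_boundary_rect_eq_zero_of_differentiableOn G (⟨a, -T⟩ : ℂ) ⟨b, T⟩ (by
      intro s hs
      have h1 : s.re ∈ uIcc a b := hs.1
      rw [uIcc_of_le hab] at h1
      refine DifferentiableAt.differentiableWithinAt ?_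
      exact (by fun_prop : DifferentiableAt ℂ (fun s : ℂ => exp (s * t)) s).mul
        (h.diff s h1.1 h1.2))
    rw [smul_sub, ← add_sub_assoc]
    exact this
  have hlim := ((hbot.sub htop).add ((hB.sub hA).const_smul I))
  have hzero := hlim.congr' (Eventually.of_forall hrect)
  have h5 := tendsto_nhds_unique hzero tendsto_const_nhds
  rw [hscale, hscale]
  congr 1
  simp only [sub_zero, zero_add, smul_eq_mul, mul_eq_zero, I_ne_zero, false_or] at h5
  exact (sub_eq_zero.1 h5).symm

lemma mono (h : StripDecay F a b) {a' b' : ℝ} (ha : a ≤ a') (hb : b' ≤ b) : StripDecay F a' b' where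
  diff s h1 h2 := h.diff s (ha.trans h1) (h2.trans hb)
  decay := by
    obtain ⟨C, hC⟩ := h.decay
    exact ⟨C, fun s h1 h2 => hC s (ha.trans h1) (h2.trans hb)⟩

end StripDecay

end VerticalLines

/-! ### Laplace transforms of functions at rest for early times -/

/-- Continuous functions that vanish for early times and grow at most like `exp (B t)`. -/
structure LateExp (B : ℝ) (f : ℝ → ℝ) : Prop where
  continuous : Continuous f
  rest : ∃ t₀, ∀ t ≤ t₀, f t = 0
  growth : ∃ C, ∀ t, |f t| ≤ C * Real.exp (B * t)

/-- The bilateral Laplace transform. -/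
noncomputable def laplace (f : ℝ → ℝ) (s : ℂ) : ℂ := ∫ t : ℝ, Complex.exp (-s * t) * f t

namespace LateExp

variable {B : ℝ} {f g : ℝ → ℝ} {s : ℂ}

lemma add (hf : LateExp B f) (hg : LateExp B g) : LateExp B fun t => f t + g t where
  continuous := hf.continuous.add hg.continuous
  rest := by
    obtain ⟨a, ha⟩ := hf.rest
    obtain ⟨b, hb⟩ := hg.rest
    refine ⟨min a b, fun t ht => ?_⟩
    rw [ha t (ht.trans (min_le_left _ _)), hb t (ht.trans (min_le_right _ _)), add_zero]
  growth := by
    obtain ⟨C, hC⟩ := hf.growth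
    obtain ⟨D, hD⟩ := hg.growth
    refine ⟨C + D, fun t => (abs_add_le _ _).trans ?_⟩
    rw [add_mul]
    exact add_le_add (hC t) (hD t)

lemma const_mul (c : ℝ) (hf : LateExp B f) : LateExp B fun t => c * f t where
  continuous := continuous_const.mul hf.continuous
  rest := by
    obtain ⟨a, ha⟩ := hf.rest
    exact ⟨a, fun t ht => by rw [ha t ht, mul_zero]⟩
  growth := by
    obtain ⟨C, hC⟩ := hf.growth
    refine ⟨|c| * C, fun t => ?_⟩
    rw [abs_mul, mul_assoc]
    exact mul_le_mul_of_nonneg_left (hC t) (abs_nonneg c)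

lemma integrable (hf : LateExp B f) (hs : B < s.re) :
    Integrable fun t : ℝ => Complex.exp (-s * t) * f t := by
  obtain ⟨a, ha⟩ := hf.rest
  obtain ⟨C, hC⟩ := hf.growth
  have hcont : Continuous fun t : ℝ => Complex.exp (-s * t) * f t := by
    have := hf.continuous
    fun_prop
  have h1 : IntegrableOn (fun t : ℝ => Complex.exp (-s * t) * f t) (Ioi a) := by
    refine Integrable.mono' ((integrableOn_exp_mul_Ioi (a := B - s.re) (by linarith) a).const_mul C)
      hcont.aestronglyMeasurable (Eventually.of_forall fun t => ?_)
    rw [norm_mul, Complex.norm_exp, Complex.norm_real, Real.norm_eq_abs]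
    have h2 : (-s * (t : ℂ)).re = -s.re * t := by simp
    rw [h2]
    calc Real.exp (-s.re * t) * |f t| ≤ Real.exp (-s.re * t) * (C * Real.exp (B * t)) := by
          gcongr
          exact hC t
      _ = C * Real.exp ((B - s.re) * t) := by
          rw [mul_left_comm, ← Real.exp_add]
          ring_nf
  have h2 : IntegrableOn (fun t : ℝ => Complex.exp (-s * t) * f t) (Iic a) :=
    integrableOn_zero.congr_fun (fun t ht => by simp [ha t ht]) measurableSet_Iic
  have := h2.union h1
  rwa [Iic_union_Ioi, integrableOn_univ] at this

lemma laplace_add (hf : LateExp B f) (hg : LateExp B g) (hs : B < s.re) :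
    laplace (fun t => f t + g t) s = laplace f s + laplace g s := by
  rw [laplace, laplace, laplace, ← integral_add (hf.integrable hs) (hg.integrable hs)]
  congr 1
  ext t
  push_cast
  ring

lemma _root_.laplace_const_mul (c : ℝ) (f : ℝ → ℝ) (s : ℂ) :
    laplace (fun t => c * f t) s = c * laplace f s := by
  rw [laplace, laplace, ← integral_const_mul]
  congr 1
  ext t
  push_cast
  ring

lemma laplace_deriv (hf : LateExp B f) (hg : LateExp B g) (hd : ∀ t, HasDerivAt f (g t) t)
    (hs : B < s.re) : laplace g s = s * laplace f s := by
  have h1 : ∀ t : ℝ, HasDerivAt (fun t : ℝ => Complex.exp (-s * t) * f t)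
      (Complex.exp (-s * t) * g t - s * (Complex.exp (-s * t) * f t)) t := by
    intro t
    have h2 : HasDerivAt (fun z : ℂ => Complex.exp (-s * z)) (Complex.exp (-s * t) * (-s * 1)) (t : ℂ) :=
      ((hasDerivAt_id (t : ℂ)).const_mul (-s)).cexp
    convert! h2.comp_ofReal.mul (hd t).ofReal_comp using 1
    ring
  have h3 := integral_eq_zero_of_hasDerivAt_of_integrable h1
    ((hg.integrable hs).sub ((hf.integrable hs).const_mul s)) (hf.integrable hs)
  rw [integral_sub (hg.integrable hs) ((hf.integrable hs).const_mul s), integral_const_mul] at h3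
  exact sub_eq_zero.1 h3

/-- Fourier inversion for `exp (-σ t) * f t`; continuity of `f` gives equality at every `t`. -/
lemma invLaplace_laplace (hf : LateExp B f) {σ : ℝ} (hσ : B < σ)
    (hint : Integrable fun ξ : ℝ => laplace f (linePoint σ ξ)) (t : ℝ) :
    invLaplace (laplace f) σ t = f t := by
  set g : ℝ → ℂ := fun t => Complex.exp (-σ * t) * f t with hg
  have h1 : Integrable g := by
    exact hf.integrable (s := σ) (by simpa using hσ)
  have h2 : FourierTransform.fourier g = fun ξ => laplace f (linePoint σ ξ) := by
    ext ξ
    rw [Real.fourier_eq', laplace]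
    congr 1
    ext t
    rw [smul_eq_mul, hg, ← mul_assoc, ← Complex.exp_add]
    congr 2
    simp [linePoint]
    ring
  have hcont : Continuous g := by
    have := hf.continuous
    fun_prop
  have h3 := hcont.fourierInv_fourier_eq h1 (by rw [h2]; exact hint)
  rw [invLaplace_eq_fourierInv, ← h2, h3, hg, ← mul_assoc, ← Complex.exp_add]
  simp

end LateExp

/-! ### Growth of the motions and the transformed equations -/

/-- Exponential growth of the solutions of linear systems, with an exponent that does not depend
on the dimension. -/
lemma exists_growth_bound {ι : Type*} [Fintype ι] {A P t₀ : ℝ} (hA : 0 < A) (hP : 0 ≤ P)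
    {x y x' y' : ι → ℝ → ℝ} (hx : ∀ i t, HasDerivAt (x i) (x' i t) t)
    (hy : ∀ i t, HasDerivAt (y i) (y' i t) t) (hx0 : ∀ i, ∀ t ≤ t₀, x i t = 0)
    (hy0 : ∀ i, ∀ t ≤ t₀, y i t = 0)
    (hb : ∀ t M, 0 ≤ M → (∀ j, |x j t| ≤ M ∧ |y j t| ≤ M) →
      ∀ i, |x' i t| ≤ A * (M + P) ∧ |y' i t| ≤ A * (M + P)) :
    ∀ i t, |x i t| ≤ P * Real.exp (-A * t₀) * Real.exp (A * t) ∧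
      |y i t| ≤ P * Real.exp (-A * t₀) * Real.exp (A * t) := by
  -- Grönwall in the supremum norm over the agents: the constant `A` then does not see their number.
  set X : ℝ → ι → ℝ × ℝ := fun t i => (x i t, y i t) with hX
  set X' : ℝ → ι → ℝ × ℝ := fun t i => (x' i t, y' i t) with hX'
  have hder : ∀ t, HasDerivAt X (X' t) t := fun t =>
    hasDerivAt_pi.2 fun i => (hx i t).prodMk (hy i t)
  have hcomp : ∀ t j, |x j t| ≤ ‖X t‖ ∧ |y j t| ≤ ‖X t‖ := fun t j =>
    ⟨(norm_fst_le (X t j)).trans (norm_le_pi_norm (X t) j),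
      (norm_snd_le (X t j)).trans (norm_le_pi_norm (X t) j)⟩
  intro i t
  rcases le_total t t₀ with ht | ht
  · rw [hx0 i t ht, hy0 i t ht, abs_zero]
    exact ⟨by positivity, by positivity⟩
  · have h1 := norm_le_gronwallBound_of_norm_deriv_right_le (f := X) (f' := X') (δ := 0) (K := A)
      (ε := A * P) (a := t₀) (b := t)
      (fun r _ => (hder r).continuousAt.continuousWithinAt)
      (fun r _ => (hder r).hasDerivWithinAt)
      (by
        have : X t₀ = 0 := by
          ext i <;> simp [hX, hx0 i t₀ le_rfl, hy0 i t₀ le_rfl]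
        simp [this])
      (fun r _ => by
        rw [← mul_add, pi_norm_le_iff_of_nonneg (by positivity)]
        intro j
        have := hb r ‖X r‖ (norm_nonneg _) (hcomp r) j
        rw [Prod.norm_def]
        exact max_le this.1 this.2) t ⟨ht, le_rfl⟩
    have h2 : gronwallBound 0 A (A * P) (t - t₀) ≤ P * Real.exp (-A * t₀) * Real.exp (A * t) := by
      rw [gronwallBound_of_K_ne_0 hA.ne', mul_assoc, ← Real.exp_add, mul_div_cancel_left₀ _ hA.ne']
      have : A * (t - t₀) = -A * t₀ + A * t := by ring
      simp only [this]
      linarith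
    exact ⟨((hcomp t i).1.trans h1).trans h2, ((hcomp t i).2.trans h1).trans h2⟩

/-- The elimination of the inner agents from a three term recursion. -/
lemma transfer_recursion {u w : ℂ} {Z : ℕ → ℂ} (n : ℕ)
    (h : ∀ k, 1 ≤ k → k < n + 1 →
      (1 - u) * (1 - w) * Z k = u * (Z (k - 1) - Z k) + w * (Z (k + 1) - Z k)) :
    u ^ n * (1 - u * w) * Z 0
      = w * (u * w) ^ n * (Z (n + 1) - u * Z n) - (w * Z (n + 1) - Z n) := by
  -- The recursion reads `(1 + u * w) * Z k = u * Z (k - 1) + w * Z (k + 1)`, with roots `u` and `1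
  -- / w`. Each first-order combination removes one root and is geometric in the other. Nothing is
  -- divided by `w`, which may vanish.
  have h1 : ∀ k ≤ n, w * Z (k + 1) - Z k = u ^ k * (w * Z 1 - Z 0) ∧
      Z 1 - u * Z 0 = w ^ k * (Z (k + 1) - u * Z k) := by
    intro k hk
    induction k with
    | zero => simp
    | succ k ih =>
      obtain ⟨e1, e2⟩ := ih (by omega)
      have e3 := h (k + 1) (by omega) (by omega)
      rw [Nat.add_sub_cancel] at e3
      constructor
      · rw [pow_succ]
        linear_combination u * e1 - e3
      · rw [e2, pow_succ]
        linear_combination w ^ k * e3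
  obtain ⟨e1, e2⟩ := h1 n le_rfl
  rw [mul_pow]
  linear_combination e1 + u ^ n * w * e2

namespace Flock

/-- The velocity coupling of agent `k`, integrated once in time. -/
noncomputable def velForce (F : Flock) (b : LastAgent) (N : ℕ) (z : ℕ → ℝ → ℝ) (k : ℕ) (t : ℝ) : ℝ :=
  if k < N then F.gv * (F.ρvm * z (k - 1) t + F.ρv0 * z k t + F.ρvp * z (k + 1) t)
  else F.gv * b.βv F * (-z (N - 1) t + z N t)

/-- The position coupling of agent `k`. -/
noncomputable def posForce (F : Flock) (b : LastAgent) (N : ℕ) (z : ℕ → ℝ → ℝ) (k : ℕ) (t : ℝ) : ℝ :=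
  if k < N then F.gx * (F.ρxm * z (k - 1) t + F.ρx0 * z k t + F.ρxp * z (k + 1) t)
  else F.gx * b.βx F * (-z (N - 1) t + z N t)

/-- A growth exponent for all motions of the flock, whatever the number of agents. -/
noncomputable def growthRate (F : Flock) (b : LastAgent) : ℝ :=
  1 + |F.gv| * (|F.ρvm| + |F.ρv0| + |F.ρvp| + 2 * |b.βv F|)
    + |F.gx| * (|F.ρxm| + |F.ρx0| + |F.ρxp| + 2 * |b.βx F|)

lemma growthRate_pos (F : Flock) (b : LastAgent) : 0 < F.growthRate b := by
  unfold growthRate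
  positivity

/-- The term in `β` here, like those in `a`, `b`, `c` in `abs_two_le`, is slack that lets inner
agents and the last agent share one bound. -/
lemma abs_three_le {g a b c β x y z M : ℝ} (hx : |x| ≤ M) (hy : |y| ≤ M) (hz : |z| ≤ M) :
    |g * (a * x + b * y + c * z)| ≤ |g| * (|a| + |b| + |c| + 2 * |β|) * M := by
  have hM : 0 ≤ M := (abs_nonneg _).trans hx
  rw [abs_mul, mul_assoc]
  gcongr
  calc |a * x + b * y + c * z| ≤ |a| * |x| + |b| * |y| + |c| * |z| := by
        rw [← abs_mul, ← abs_mul, ← abs_mul]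
        exact abs_add_three _ _ _
    _ ≤ |a| * M + |b| * M + |c| * M + 2 * |β| * M := by
        have : 0 ≤ 2 * |β| * M := by positivity
        have := mul_le_mul_of_nonneg_left hx (abs_nonneg a)
        have := mul_le_mul_of_nonneg_left hy (abs_nonneg b)
        have := mul_le_mul_of_nonneg_left hz (abs_nonneg c)
        linarith
    _ = _ := by ring

lemma abs_two_le {g a b c β x y M : ℝ} (hx : |x| ≤ M) (hy : |y| ≤ M) :
    |g * β * (-x + y)| ≤ |g| * (|a| + |b| + |c| + 2 * |β|) * M := by
  have hM : 0 ≤ M := (abs_nonneg _).trans hx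
  have h1 : |-x + y| ≤ 2 * M := by
    refine (abs_add_le _ _).trans ?_
    rw [abs_neg]
    linarith
  rw [abs_mul, abs_mul, mul_assoc, mul_assoc]
  refine mul_le_mul_of_nonneg_left ?_ (abs_nonneg g)
  calc |β| * |-x + y| ≤ |β| * (2 * M) := by gcongr
    _ ≤ (|a| + |b| + |c| + 2 * |β|) * M := by
        have : 0 ≤ (|a| + |b| + |c|) * M := by positivity
        linarith

end Flock

namespace IsPulseMotion

variable {F : Flock} {b : LastAgent} {p : ℝ → ℝ} {v₀ : ℝ} {N : ℕ} {z : ℕ → ℝ → ℝ}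

lemma forces_le (F : Flock) (b : LastAgent) {k : ℕ} (hk1 : 1 ≤ k) (hkN : k ≤ N) {t M : ℝ}
    (hM : ∀ j ≤ N, |z j t| ≤ M) :
    |F.velForce b N z k t| ≤ |F.gv| * (|F.ρvm| + |F.ρv0| + |F.ρvp| + 2 * |b.βv F|) * M ∧
    |F.posForce b N z k t| ≤ |F.gx| * (|F.ρxm| + |F.ρx0| + |F.ρxp| + 2 * |b.βx F|) * M := by
  unfold Flock.velForce Flock.posForce
  split_ifs with h
  · exact ⟨Flock.abs_three_le (hM _ (by omega)) (hM _ (by omega)) (hM _ (by omega)),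
      Flock.abs_three_le (hM _ (by omega)) (hM _ (by omega)) (hM _ (by omega))⟩
  · exact ⟨Flock.abs_two_le (hM _ (by omega)) (hM _ le_rfl),
      Flock.abs_two_le (hM _ (by omega)) (hM _ le_rfl)⟩

/-- The pulse is merely differentiable, so the leader's velocity, which enters the acceleration of
its neighbour, may be unbounded. Subtracting the integrated velocity coupling leaves a first-order
system that involves the leader's position only. -/
lemma hasDerivAt_momentum (h : IsPulseMotion F b p v₀ N z) {k : ℕ} (hk1 : 1 ≤ k) (hkN : k ≤ N)
    (t : ℝ) : HasDerivAt (fun t => deriv (z k) t - F.velForce b N z k t)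
      (F.posForce b N z k t) t := by
  have hd : ∀ j ≤ N, HasDerivAt (z j) (deriv (z j) t) t := fun j hj =>
    (h.position_differentiable j hj t).hasDerivAt
  have hv := (h.velocity_differentiable k hk1 hkN t).hasDerivAt
  unfold Flock.velForce Flock.posForce
  split_ifs with hlt
  · have h1 := (((hd (k - 1) (by omega)).const_mul F.ρvm).add
      ((hd k hkN).const_mul F.ρv0)).add ((hd (k + 1) (by omega)).const_mul F.ρvp)
    convert! hv.sub (h1.const_mul F.gv) using 1
    rw [h.interior k hk1 hlt t]
    ring
  · obtain rfl : k = N := by omega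
    have h1 := ((hd (k - 1) (by omega)).neg.add (hd k le_rfl)).const_mul (F.gv * b.βv F)
    convert! hv.sub h1 using 1
    rw [h.last t]
    ring

/-- All orbits, and their velocities without the integrated velocity coupling, are at rest for
early times and grow at most exponentially. -/
lemma lateExp (h : IsPulseMotion F b p v₀ N z) (hp : IsUnitPulse p) :
    (∀ k ≤ N, LateExp (F.growthRate b) (z k)) ∧
    ∀ k, 1 ≤ k → k ≤ N →
      LateExp (F.growthRate b) fun t => deriv (z k) t - F.velForce b N z k t := by
  set A := F.growthRate b with hA
  have hApos : 0 < A := F.growthRate_pos b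
  obtain ⟨t₀, ht₀⟩ := h.rest
  obtain ⟨P₀, hP₀⟩ := hp.compactSupport.exists_bound_of_continuous hp.differentiable.continuous
  set P := P₀ * |v₀| with hP
  have hP0 : 0 ≤ P := mul_nonneg ((norm_nonneg _).trans (hP₀ 0)) (abs_nonneg _)
  have hz0 : ∀ t, |z 0 t| ≤ P := fun t => by
    rw [h.leader, abs_mul]
    exact mul_le_mul_of_nonneg_right (hP₀ t) (abs_nonneg _)
  set C := P * Real.exp (-A * (t₀ - 1)) with hC
  -- One time unit before `t₀` the orbits vanish in a whole neighbourhood of `t`, hence so do the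
  -- velocities.
  have hy0 : ∀ k, 1 ≤ k → k ≤ N → ∀ t ≤ t₀ - 1, deriv (z k) t - F.velForce b N z k t = 0 := by
    intro k hk1 hkN t ht
    have h1 : deriv (z k) t = 0 := by
      have : z k =ᶠ[𝓝 t] fun _ => 0 := by
        filter_upwards [Iic_mem_nhds (show t < t₀ by linarith)] with x hx using ht₀ k hkN x hx
      rw [this.deriv_eq, deriv_const]
    have h2 : ∀ j ≤ N, |z j t| ≤ 0 := fun j hj => by rw [ht₀ j hj t (by linarith), abs_zero]
    have h3 := (forces_le F b hk1 hkN h2).1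
    rw [mul_zero] at h3
    rw [h1, abs_nonpos_iff.1 h3, sub_zero]
  have hgrow := exists_growth_bound (ι := Fin N) (A := A) (P := P) (t₀ := t₀ - 1)
    (x := fun i => z (i + 1)) (y := fun i t => deriv (z (i + 1)) t - F.velForce b N z (i + 1) t)
    (x' := fun i => deriv (z (i + 1))) (y' := fun i t => F.posForce b N z (i + 1) t) hApos hP0
    (fun i t => (h.position_differentiable _ (by omega) t).hasDerivAt)
    (fun i t => h.hasDerivAt_momentum (by omega) (by omega) t)
    (fun i t ht => ht₀ _ (by omega) _ (by linarith))
    (fun i t ht => hy0 _ (by omega) (by omega) t ht)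
    (by
      intro t M hM hb i
      have h1 : ∀ j ≤ N, |z j t| ≤ M + P := by
        intro j hj
        rcases j with _ | j
        · linarith [hz0 t]
        · linarith [(hb ⟨j, by omega⟩).1]
      obtain ⟨h2, h3⟩ := forces_le F b (k := i + 1) (by omega) (by omega) h1
      have h4 := (hb i).2
      have hMP : 0 ≤ M + P := by linarith
      have e1 : 0 ≤ |F.gv| * (|F.ρvm| + |F.ρv0| + |F.ρvp| + 2 * |b.βv F|) * (M + P) := by positivity
      have e2 : 0 ≤ |F.gx| * (|F.ρxm| + |F.ρx0| + |F.ρxp| + 2 * |b.βx F|) * (M + P) := by positivity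
      -- In `growthRate` the summand `1` pays for the momentum, the other two for the couplings.
      have hAe : A * (M + P) = (M + P)
          + |F.gv| * (|F.ρvm| + |F.ρv0| + |F.ρvp| + 2 * |b.βv F|) * (M + P)
          + |F.gx| * (|F.ρxm| + |F.ρx0| + |F.ρxp| + 2 * |b.βx F|) * (M + P) := by
        rw [hA, Flock.growthRate]; ring
      constructor
      · have h5 : deriv (z (i + 1)) t = (deriv (z (i + 1)) t - F.velForce b N z (i + 1) t)
          + F.velForce b N z (i + 1) t := by ring
        rw [h5]
        refine (abs_add_le _ _).trans ?_
        linarith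
      · linarith)
  refine ⟨fun k hk => ⟨(h.position_differentiable k hk).continuous, ⟨t₀, ht₀ k hk⟩, C, fun t => ?_⟩,
    fun k hk1 hkN => ⟨?_, ⟨t₀ - 1, hy0 k hk1 hkN⟩, C, fun t => ?_⟩⟩
  · rcases k with _ | k
    · rcases le_total t t₀ with ht | ht
      · rw [ht₀ 0 hk t ht, abs_zero]
        positivity
      · refine (hz0 t).trans ?_
        rw [hC, mul_assoc, ← Real.exp_add]
        refine le_mul_of_one_le_right hP0 (Real.one_le_exp ?_)
        nlinarith
    · exact (hgrow ⟨k, by omega⟩ t).1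
  · exact continuous_iff_continuousAt.2 fun t => (h.hasDerivAt_momentum hk1 hkN t).continuousAt
  · obtain ⟨i, rfl⟩ : ∃ i, k = i + 1 := ⟨k - 1, by omega⟩
    exact (hgrow ⟨i, by omega⟩ t).2

/-- The equations of motion after a Laplace transform. -/
lemma laplace_eq (h : IsPulseMotion F b p v₀ N z) (hp : IsUnitPulse p) {s : ℂ}
    (hs : F.growthRate b < s.re) :
    (∀ k, 1 ≤ k → k < N → s ^ 2 * laplace (z k) s
      = F.gx * (F.ρxm * laplace (z (k - 1)) s + F.ρx0 * laplace (z k) s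
          + F.ρxp * laplace (z (k + 1)) s)
        + F.gv * s * (F.ρvm * laplace (z (k - 1)) s + F.ρv0 * laplace (z k) s
          + F.ρvp * laplace (z (k + 1)) s)) ∧
    (1 ≤ N → s ^ 2 * laplace (z N) s
      = F.gx * b.βx F * (-laplace (z (N - 1)) s + laplace (z N) s)
        + F.gv * b.βv F * s * (-laplace (z (N - 1)) s + laplace (z N) s)) := by
  obtain ⟨hz, hy⟩ := h.lateExp hp
  have key : ∀ k, 1 ≤ k → k ≤ N → LateExp (F.growthRate b) (F.velForce b N z k) →
      LateExp (F.growthRate b) (F.posForce b N z k) →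
      s ^ 2 * laplace (z k) s = laplace (F.posForce b N z k) s
        + s * laplace (F.velForce b N z k) s := by
    intro k hk1 hkN hV hX
    have e1 := (hy k hk1 hkN).laplace_deriv hX (fun t => h.hasDerivAt_momentum hk1 hkN t) hs
    have e2 := (hz k hkN).laplace_deriv ((hy k hk1 hkN).add hV) (fun t => by
      have := (h.position_differentiable k hkN t).hasDerivAt
      convert! this using 1
      ring) hs
    rw [(hy k hk1 hkN).laplace_add hV hs] at e2
    rw [e1]
    linear_combination (-s) * e2
  constructor
  · intro k hk1 hkN
    have h1 := hz (k - 1) (by omega)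
    have h2 := hz k (by omega)
    have h3 := hz (k + 1) (by omega)
    have lin : ∀ g a a' c : ℝ,
        LateExp (F.growthRate b) (fun t => g * (a * z (k - 1) t + a' * z k t + c * z (k + 1) t)) ∧
        laplace (fun t => g * (a * z (k - 1) t + a' * z k t + c * z (k + 1) t)) s
          = g * (a * laplace (z (k - 1)) s + a' * laplace (z k) s + c * laplace (z (k + 1)) s) := by
      intro g a a' c
      have h4 := (h1.const_mul a).add (h2.const_mul a')
      refine ⟨(h4.add (h3.const_mul c)).const_mul g, ?_⟩
      rw [laplace_const_mul, h4.laplace_add (h3.const_mul c) hs,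
        (h1.const_mul a).laplace_add (h2.const_mul a') hs, laplace_const_mul, laplace_const_mul,
        laplace_const_mul]
    have eV : F.velForce b N z k = fun t =>
        F.gv * (F.ρvm * z (k - 1) t + F.ρv0 * z k t + F.ρvp * z (k + 1) t) := by
      ext t; simp [Flock.velForce, hkN]
    have eX : F.posForce b N z k = fun t =>
        F.gx * (F.ρxm * z (k - 1) t + F.ρx0 * z k t + F.ρxp * z (k + 1) t) := by
      ext t; simp [Flock.posForce, hkN]
    have := key k hk1 hkN.le (by rw [eV]; exact (lin _ _ _ _).1) (by rw [eX]; exact (lin _ _ _ _).1)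
    rw [this, eV, eX, (lin _ _ _ _).2, (lin _ _ _ _).2]
    ring
  · intro hN
    have h1 := hz (N - 1) (by omega)
    have h2 := hz N le_rfl
    have lin : ∀ g : ℝ,
        LateExp (F.growthRate b) (fun t => g * (-1 * z (N - 1) t + z N t)) ∧
        laplace (fun t => g * (-1 * z (N - 1) t + z N t)) s
          = g * (-laplace (z (N - 1)) s + laplace (z N) s) := by
      intro g
      refine ⟨((h1.const_mul (-1)).add h2).const_mul g, ?_⟩
      rw [laplace_const_mul, (h1.const_mul (-1)).laplace_add h2 hs, laplace_const_mul]
      push_cast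
      ring
    have eV : F.velForce b N z N = fun t => F.gv * b.βv F * (-1 * z (N - 1) t + z N t) := by
      ext t; simp [Flock.velForce]
    have eX : F.posForce b N z N = fun t => F.gx * b.βx F * (-1 * z (N - 1) t + z N t) := by
      ext t; simp [Flock.posForce]
    have := key N hN le_rfl (by rw [eV]; exact (lin _).1) (by rw [eX]; exact (lin _).1)
    rw [this, eV, eX, (lin _).2, (lin _).2]
    push_cast
    ring

end IsPulseMotion

/-! ### Gain and reflection coefficient -/

namespace Dispersion

/-- The amplitude of the transfer function from the leader to the last agent. -/
noncomputable def gain (α β d : ℝ) (b : LastAgent) (s : ℂ) : ℂ :=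
  match b with
  | .variableMass => mult α β d s * (1 + mult α β (-d) s * ratio α β d s)
  | .regular => (mult α β d s + mult α β (-d) s) * (1 + mult α β (-d) s * ratio α β d s)
      * invOneAdd α β d s

/-- The reflection coefficient at the last agent. -/
noncomputable def reflCoeff (α β d : ℝ) (b : LastAgent) (s : ℂ) : ℂ :=
  match b with
  | .variableMass => mult α β d s * mult α β (-d) s ^ 2 * ratio α β d s
  | .regular => mult α β (-d) s ^ 2 * ratio α β d s * (1 + mult α β d s) * invOneAdd α β d s

variable {α β d η : ℝ} {s : ℂ}

lemma Regular.differentiableAt_gain (h : Regular α β d s) (b : LastAgent) :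
    DifferentiableAt ℂ (gain α β d b) s := by
  have h1 := h.differentiableAt_mult
  have h2 := h.neg.differentiableAt_mult
  have h3 := h.differentiableAt_ratio
  have h4 := h.differentiableAt_invOneAdd
  cases b <;> unfold gain <;> dsimp only <;> fun_prop

lemma Regular.differentiableAt_reflCoeff (h : Regular α β d s) (b : LastAgent) :
    DifferentiableAt ℂ (reflCoeff α β d b) s := by
  have h1 := h.differentiableAt_mult
  have h2 := h.neg.differentiableAt_mult
  have h3 := h.differentiableAt_ratio
  have h4 := h.differentiableAt_invOneAdd
  cases b <;> unfold reflCoeff <;> dsimp only <;> fun_prop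

lemma ratio_zero (hα : 0 < α) :
    ratio α β d 0 = (speed α (-d) / speed α d : ℝ) := by
  have h1 := half_zero_add (α := α) (β := β) (d := -d) hα
  rw [half_neg] at h1
  rw [ratio, half_zero_add hα]
  push_cast at h1 ⊢
  rw [← h1]
  ring

lemma invOneAdd_zero (h : Regular α β d 0) : invOneAdd α β d 0 = 1 / 2 := by
  have := invOneAdd_mul h
  rw [mult_zero] at this
  linear_combination this / 2

/-- At the origin both multipliers are `1`, so the boundary conditions become indistinguishable;
with `reflCoeff_zero` this is why they share one reflection series. -/
lemma gain_zero (hα : 0 < α) (h : Regular α β d 0) (b : LastAgent) :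
    gain α β d b 0 = (1 + speed α (-d) / speed α d : ℝ) := by
  cases b <;> simp [gain, mult_zero, ratio_zero hα, invOneAdd_zero h]
  ring

lemma reflCoeff_zero (hα : 0 < α) (h : Regular α β d 0) (b : LastAgent) :
    reflCoeff α β d b 0 = (speed α (-d) / speed α d : ℝ) := by
  cases b <;> simp [reflCoeff, mult_zero, ratio_zero hα, invOneAdd_zero h]
  ring

section Bounds

/-- A common bound for all the functions of this section. -/
lemma exists_bounds (hβ : 0 < β) (hη1 : η ≤ 1 / 2) (hη : η ≤ β / 2)
    (hreg : ∀ s : ℂ, -η ≤ s.re → Regular α β d s) (b : LastAgent) :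
    ∃ C : ℝ, 1 ≤ C ∧ ∀ s : ℂ, -η ≤ s.re →
      ‖mult α β d s‖ * ‖1 + s‖ ≤ C ∧ ‖mult α β (-d) s‖ * ‖1 + s‖ ≤ C ∧
      ‖gain α β d b s‖ ≤ C ∧ ‖reflCoeff α β d b s‖ ≤ C := by
  obtain ⟨C₁, h1⟩ := exists_bound_mult hβ hη hreg
  obtain ⟨C₂, h2⟩ := exists_bound_mult hβ hη fun s hs => (hreg s hs).neg
  obtain ⟨C₃, h3⟩ := exists_bound_ratio hβ hη hreg
  obtain ⟨C₄, h4⟩ := exists_bound_invOneAdd hβ hη hreg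
  set C := 2 * (|C₁| + |C₂| + |C₃| + |C₄|) + 1 with hC
  have a1 := abs_nonneg C₁
  have a2 := abs_nonneg C₂
  have a3 := abs_nonneg C₃
  have a4 := abs_nonneg C₄
  have hC1 : 1 ≤ C := by linarith
  refine ⟨16 * C ^ 5, by linarith [one_le_pow₀ hC1 (n := 5)], fun s hs => ?_⟩
  have hs1 : 1 / 2 ≤ ‖1 + s‖ := by
    refine le_trans ?_ (Complex.re_le_norm _)
    simp
    linarith
  have e1 := h1 s hs
  have e2 := h2 s hs
  have hu : ‖mult α β d s‖ ≤ C := by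
    have := mul_le_mul_of_nonneg_left hs1 (norm_nonneg (mult α β d s))
    linarith [le_abs_self C₁]
  have hw : ‖mult α β (-d) s‖ ≤ C := by
    have := mul_le_mul_of_nonneg_left hs1 (norm_nonneg (mult α β (-d) s))
    linarith [le_abs_self C₂]
  have hk : ‖ratio α β d s‖ ≤ C := (h3 s hs).trans (by linarith [le_abs_self C₃])
  have hn : ‖invOneAdd α β d s‖ ≤ C := (h4 s hs).trans (by linarith [le_abs_self C₄])
  have hC5 : ∀ k ≤ 5, C ^ k ≤ C ^ 5 := fun k hk => pow_le_pow_right₀ hC1 hk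
  have hC5' : C ≤ C ^ 5 := by simpa using hC5 1 (by norm_num)
  have hone : ∀ x : ℂ, ‖1 + x‖ ≤ 1 + ‖x‖ := fun x => (norm_add_le _ _).trans (by simp)
  have hwk : ‖1 + mult α β (-d) s * ratio α β d s‖ ≤ 2 * C ^ 2 := by
    refine (hone _).trans ?_
    rw [norm_mul]
    have : ‖mult α β (-d) s‖ * ‖ratio α β d s‖ ≤ C * C := by gcongr
    nlinarith
  have h1u : ‖1 + mult α β d s‖ ≤ 2 * C := (hone _).trans (by linarith)
  refine ⟨?_, ?_, ?_, ?_⟩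
  · linarith [le_abs_self C₁]
  · linarith [le_abs_self C₂]
  · cases b
    · calc ‖gain α β d .variableMass s‖
          = ‖mult α β d s‖ * ‖1 + mult α β (-d) s * ratio α β d s‖ := norm_mul _ _
        _ ≤ C * (2 * C ^ 2) := by gcongr
        _ ≤ 16 * C ^ 5 := by linarith [hC5 3 (by norm_num), hC1.trans hC5']
    · calc ‖gain α β d .regular s‖
          = ‖mult α β d s + mult α β (-d) s‖ * ‖1 + mult α β (-d) s * ratio α β d s‖
            * ‖invOneAdd α β d s‖ := by rw [gain, norm_mul, norm_mul]
        _ ≤ (C + C) * (2 * C ^ 2) * C := by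
            gcongr
            exact (norm_add_le _ _).trans (by gcongr)
        _ ≤ 16 * C ^ 5 := by linarith [hC5 4 (by norm_num), hC1.trans hC5']
  · cases b
    · calc ‖reflCoeff α β d .variableMass s‖
          = ‖mult α β d s‖ * ‖mult α β (-d) s‖ ^ 2 * ‖ratio α β d s‖ := by
            rw [reflCoeff, norm_mul, norm_mul, norm_pow]
        _ ≤ C * C ^ 2 * C := by gcongr
        _ ≤ 16 * C ^ 5 := by linarith [hC5 4 (by norm_num), hC1.trans hC5']
    · calc ‖reflCoeff α β d .regular s‖
          = ‖mult α β (-d) s‖ ^ 2 * ‖ratio α β d s‖ * ‖1 + mult α β d s‖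
            * ‖invOneAdd α β d s‖ := by rw [reflCoeff, norm_mul, norm_mul, norm_mul, norm_pow]
        _ ≤ C ^ 2 * C * (2 * C) * C := by gcongr
        _ ≤ 16 * C ^ 5 := by linarith [hC5 5 (by norm_num), hC1.trans hC5']

end Bounds

end Dispersion

/-! ### Signal velocities and the transfer function -/

namespace Flock

/-- Half the difference of the velocity couplings. -/
noncomputable def drift (F : Flock) : ℝ := -(F.gv * (1 + 2 * F.ρvp)) / 2

lemma cPlus_eq (F : Flock) : F.cPlus = Dispersion.speed (-F.gx) F.drift := by
  rw [cPlus, Dispersion.speed, drift]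
  have : 2 * -F.gx + 4 * (-(F.gv * (1 + 2 * F.ρvp)) / 2) ^ 2
      = 2 ^ 2 * (F.gv ^ 2 * (1 + 2 * F.ρvp) ^ 2 / 4 - F.gx / 2) := by ring
  rw [this, Real.sqrt_mul (by norm_num), Real.sqrt_sq (by norm_num)]
  ring

lemma cMinus_eq (F : Flock) : F.cMinus = -Dispersion.speed (-F.gx) (-F.drift) := by
  rw [cMinus, Dispersion.speed, drift]
  have : 2 * -F.gx + 4 * (-(-(F.gv * (1 + 2 * F.ρvp)) / 2)) ^ 2
      = 2 ^ 2 * (F.gv ^ 2 * (1 + 2 * F.ρvp) ^ 2 / 4 - F.gx / 2) := by ring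
  rw [this, Real.sqrt_mul (by norm_num), Real.sqrt_sq (by norm_num)]
  ring

end Flock

open Dispersion in
/-- The transfer function from the leader to the last agent. -/
lemma IsPulseMotion.transfer {F : Flock} (hF : F.Normalized) {b : LastAgent} {p : ℝ → ℝ}
    (hp : IsUnitPulse p) {v₀ : ℝ} {n : ℕ} {z : ℕ → ℝ → ℝ}
    (h : IsPulseMotion F b p v₀ (n + 1) z) {s : ℂ} (hs : F.growthRate b < s.re)
    (hreg : Regular (-F.gx) (-F.gv) F.drift s) :
    laplace (z (n + 1)) s * (1 + reflCoeff (-F.gx) (-F.gv) F.drift b s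
        * (mult (-F.gx) (-F.gv) F.drift s * mult (-F.gx) (-F.gv) (-F.drift) s) ^ n)
      = v₀ * laplace p s * mult (-F.gx) (-F.gv) F.drift s ^ n
        * gain (-F.gx) (-F.gv) F.drift b s := by
  have hZ0 : laplace (z 0) s = v₀ * laplace p s := by
    rw [← laplace_const_mul]
    congr 1
    ext t
    rw [h.leader, mul_comm]
  rw [← hZ0]
  obtain ⟨hint, hlast⟩ := h.laplace_eq hp hs
  have hlast := hlast (by omega)
  have m1 := mult_mul_half hreg
  have m2 := mult_neg_mul_half hreg
  have m3 := one_sub_mul_half hreg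
  have m4 := half_mul_ne_zero hreg
  have m5 := ratio_mul hreg
  have m6 := invOneAdd_mul hreg
  have hs0 : s ≠ 0 := by
    rintro rfl
    have := F.growthRate_pos b
    simp at hs
    linarith
  simp only [gain, reflCoeff]
  generalize laplace p s = P at *
  generalize hu : mult (-F.gx) (-F.gv) F.drift s = u at *
  generalize hw : mult (-F.gx) (-F.gv) (-F.drift) s = w at *
  generalize ratio (-F.gx) (-F.gv) F.drift s = κ at *
  generalize invOneAdd (-F.gx) (-F.gv) F.drift s = ν at *
  generalize 2 * ((half (-F.gx) (-F.gv) F.drift s - F.drift)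
    * (half (-F.gx) (-F.gv) F.drift s + F.drift)) = M at *
  -- Since `(1 - u) * (1 - w)` is proportional to `s ^ 2 ≠ 0`, the factor `1 - w` can be cancelled;
  -- this gives `κ` its meaning `(1 - u) / (1 - w)`.
  have hw1 : 1 - w ≠ 0 := by
    intro h0
    rw [h0] at m3
    simp [hs0] at m3
  have hρ : (F.ρvm : ℂ) = -1 - F.ρvp := by
    have := hF.v_sum
    rw [hF.v_center] at this
    have h2 : F.ρvm = -1 - F.ρvp := by linarith
    rw [h2]; push_cast; ring
  simp only [Flock.drift] at m1 m2
  push_cast at m1 m2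
  have hrec : ∀ k, 1 ≤ k → k < n + 1 → (1 - u) * (1 - w) * laplace (z k) s
      = u * (laplace (z (k - 1)) s - laplace (z k) s)
        + w * (laplace (z (k + 1)) s - laplace (z k) s) := by
    intro k hk1 hk2
    have e := hint k hk1 hk2
    rw [hF.x_center, hF.v_center, hF.x_front, hF.x_back, hρ] at e
    push_cast at e
    refine mul_right_cancel₀ m4 ?_
    linear_combination 2 * e + laplace (z k) s * m3
      - (laplace (z (k - 1)) s - laplace (z k) s) * m1
      - (laplace (z (k + 1)) s - laplace (z k) s) * m2
  have hrec' := transfer_recursion (Z := fun k => laplace (z k) s) n hrec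
  beta_reduce at hrec'
  rw [Nat.add_sub_cancel] at hlast
  generalize laplace (z (n + 1)) s = Z at *
  generalize laplace (z n) s = Y at *
  generalize laplace (z 0) s = X at *
  cases b
  · simp only [LastAgent.βx, LastAgent.βv] at hlast
    rw [hF.x_front] at hlast
    push_cast at hlast
    rw [hρ] at hlast
    -- This is the interior recursion with a fictitious agent behind the last one that copies the
    -- last agent.
    have hb : (1 - u) * (1 - w) * Z = u * (Y - Z) := by
      refine mul_right_cancel₀ m4 ?_
      linear_combination 2 * hlast + Z * m3 - (Y - Z) * m1
    simp only
    refine mul_right_cancel₀ hw1 ?_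
    linear_combination (-u) * hrec' + (1 - w * (u * w) ^ n * u) * hb
      + (Z * u * w ^ 2 * (u * w) ^ n - X * u ^ n * u * w) * m5
  · simp only [LastAgent.βx, LastAgent.βv] at hlast
    push_cast at hlast
    -- Here the fictitious agent copies the last but one.
    have hb : (1 - u) * (1 - w) * Z = (u + w) * (Y - Z) := by
      refine mul_right_cancel₀ m4 ?_
      linear_combination 2 * hlast + Z * m3 - (Y - Z) * (m1 + m2)
    simp only
    have h1w : 1 + w ≠ 0 := by
      intro h0
      rw [h0] at m6
      simp at m6
    refine mul_right_cancel₀ (mul_ne_zero hw1 h1w) ?_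
    linear_combination (-(u + w)) * hrec' + (1 - w * (u * w) ^ n * u) * hb
      + (Z * w ^ 2 * (u * w) ^ n * (1 + u) - X * u ^ n * (u + w) * w) * m5
      + (Z * w ^ 2 * (u * w) ^ n * (1 + u) * κ * (1 - w)
          - X * u ^ n * (u + w) * (1 + w * κ) * (1 - w)) * m6

/-! ### Transforms of the pulse and of the reflected signals -/

namespace IsUnitPulse

variable {p : ℝ → ℝ}

lemma exists_norm_laplace_le (hp : IsUnitPulse p) (B : ℝ) :
    ∃ C, 1 ≤ C ∧ ∀ s : ℂ, |s.re| ≤ B → ‖laplace p s‖ ≤ C := by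
  have hc := hp.differentiable.continuous
  have hint : Integrable fun t : ℝ => Real.exp (B * |t|) * |p t| := by
    refine Continuous.integrable_of_hasCompactSupport (by fun_prop) ?_
    exact hp.compactSupport.norm.mul_left
  refine ⟨max 1 (∫ t : ℝ, Real.exp (B * |t|) * |p t|), le_max_left _ _, fun s hs => ?_⟩
  refine le_trans (norm_integral_le_of_norm_le hint (Eventually.of_forall fun t => ?_))
    (le_max_right _ _)
  rw [norm_mul, Complex.norm_exp, Complex.norm_real, Real.norm_eq_abs]
  gcongr
  have h2 : (-s * (t : ℂ)).re = -s.re * t := by simp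
  rw [h2]
  calc -s.re * t ≤ |-s.re * t| := le_abs_self _
    _ = |s.re| * |t| := by rw [abs_mul, abs_neg]
    _ ≤ B * |t| := by gcongr

lemma differentiable_laplace (hp : IsUnitPulse p) : Differentiable ℂ (laplace p) := by
  intro s
  have hc := hp.differentiable.continuous
  have hbound : Integrable fun t : ℝ => |t| * (Real.exp ((|s.re| + 1) * |t|) * |p t|) := by
    refine Continuous.integrable_of_hasCompactSupport (by fun_prop) ?_
    exact (hp.compactSupport.norm.mul_left).mul_left
  have hint : Integrable fun t : ℝ => Complex.exp (-s * t) * p t := by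
    refine Continuous.integrable_of_hasCompactSupport (by fun_prop) ?_
    exact (hp.compactSupport.comp_left (g := fun x : ℝ => (x : ℂ)) (by simp)).mul_left
  refine (hasDerivAt_integral_of_dominated_loc_of_deriv_le (F := fun (s : ℂ) (t : ℝ) =>
    Complex.exp (-s * t) * p t) (F' := fun s t => -t * (Complex.exp (-s * t) * p t))
    (Metric.ball_mem_nhds s one_pos)
    (Eventually.of_forall fun x => Continuous.aestronglyMeasurable (by fun_prop)) hint
    (Continuous.aestronglyMeasurable (by fun_prop)) (Eventually.of_forall fun t x hx => ?_)
    hbound (Eventually.of_forall fun t x _ => ?_)).2.differentiableAt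
  · rw [norm_mul, norm_mul, norm_neg, Complex.norm_real, Complex.norm_real, Complex.norm_exp,
      Real.norm_eq_abs, Real.norm_eq_abs]
    gcongr
    have h2 : (-x * (t : ℂ)).re = -x.re * t := by simp
    have h3 : |x.re| ≤ |s.re| + 1 := by
      have h4 : |(x - s).re| ≤ 1 :=
        (Complex.abs_re_le_norm _).trans (by rw [← dist_eq_norm]; exact (Metric.mem_ball.1 hx).le)
      rw [Complex.sub_re] at h4
      linarith [abs_sub_abs_le_abs_sub x.re s.re]
    rw [h2]
    calc -x.re * t ≤ |-x.re * t| := le_abs_self _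
      _ = |x.re| * |t| := by rw [abs_mul, abs_neg]
      _ ≤ (|s.re| + 1) * |t| := by gcongr
  · have h := ((((hasDerivAt_id x).neg).mul_const (t : ℂ)).cexp).mul_const (p t : ℂ)
    convert! h using 1
    simp
    ring

lemma laplace_zero (hp : IsUnitPulse p) : laplace p 0 = 1 := by
  have := hp.integral_eq_one
  simp only [laplace, neg_zero, zero_mul, Complex.exp_zero, one_mul]
  rw [integral_complex_ofReal, this, Complex.ofReal_one]

end IsUnitPulse

namespace Dispersion

/-- The common ratio of the geometric series of reflections. -/
noncomputable def loop (α β d : ℝ) (b : LastAgent) (n : ℕ) (s : ℂ) : ℂ :=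
  reflCoeff α β d b s * (mult α β d s * mult α β (-d) s) ^ n

/-- The transform of the signal that reaches the last agent after `k` reflections. -/
noncomputable def pulseTerm (α β d : ℝ) (b : LastAgent) (p : ℝ → ℝ) (n k : ℕ) (s : ℂ) : ℂ :=
  laplace p s * gain α β d b s * mult α β d s ^ n * (-loop α β d b n s) ^ k

/-- The arrival time, per agent, of the signal after `k` reflections. -/
noncomputable def arrival (α d : ℝ) (k : ℕ) : ℝ :=
  (k + 1) / speed α d + k / speed α (-d)

variable {α β d η : ℝ} {s : ℂ}

lemma Regular.differentiableAt_loop (h : Regular α β d s) (b : LastAgent) (n : ℕ) :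
    DifferentiableAt ℂ (loop α β d b n) s := by
  have h1 := h.differentiableAt_mult
  have h2 := h.neg.differentiableAt_mult
  have h3 := h.differentiableAt_reflCoeff b
  unfold loop
  fun_prop

lemma Regular.differentiableAt_pulseTerm (h : Regular α β d s) (b : LastAgent) {p : ℝ → ℝ}
    (hp : IsUnitPulse p) (n k : ℕ) : DifferentiableAt ℂ (pulseTerm α β d b p n k) s := by
  have h1 := h.differentiableAt_mult
  have h2 := h.differentiableAt_gain b
  have h3 := h.differentiableAt_loop b n
  have h4 := hp.differentiable_laplace s
  unfold pulseTerm
  fun_prop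

/-- Four factors `u`, each at most `C / ‖1 + s‖`, pay for the decay of order four, which is the
origin of `4 ≤ n`; the others are at most `2 * C`. -/
lemma pow_mul_sq_le {u : ℂ} {C : ℝ} (hs : -(1 / 2) ≤ s.re) (hu : ‖u‖ * ‖1 + s‖ ≤ C) {n : ℕ}
    (hn : 4 ≤ n) : ‖u‖ ^ n * (1 + s.im ^ 2) ^ 2 ≤ 16 * C ^ 4 * (2 * C) ^ (n - 4) := by
  have hC : 0 ≤ C := le_trans (by positivity) hu
  have h1 : 1 + s.im ^ 2 ≤ 4 * ‖1 + s‖ ^ 2 := by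
    rw [Complex.sq_norm, Complex.normSq_apply]
    simp
    nlinarith [sq_nonneg s.im]
  have h2 : 1 / 2 ≤ ‖1 + s‖ := by
    refine le_trans ?_ (Complex.re_le_norm _)
    simp
    linarith
  have h3 : ‖u‖ ≤ 2 * C := by nlinarith [norm_nonneg u]
  obtain ⟨m, rfl⟩ := Nat.exists_eq_add_of_le hn
  calc ‖u‖ ^ (4 + m) * (1 + s.im ^ 2) ^ 2
      ≤ ‖u‖ ^ (4 + m) * (4 * ‖1 + s‖ ^ 2) ^ 2 := by gcongr
    _ = 16 * (‖u‖ * ‖1 + s‖) ^ 4 * ‖u‖ ^ m := by ring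
    _ ≤ 16 * C ^ 4 * (2 * C) ^ m := by gcongr
    _ = _ := by rw [Nat.add_sub_cancel_left]

variable {p : ℝ → ℝ} {b : LastAgent}

lemma stripDecay_pulseTerm (hβ : 0 < β) (hη0 : 0 < η) (hη1 : η ≤ 1 / 2) (hη : η ≤ β / 2)
    (hreg : ∀ s : ℂ, -η ≤ s.re → Regular α β d s) (hp : IsUnitPulse p) {n : ℕ} (hn : 4 ≤ n)
    (k : ℕ) (B : ℝ) : StripDecay (pulseTerm α β d b p n k) (-η) B where
  diff s h1 _ := (hreg s h1).differentiableAt_pulseTerm b hp n k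
  decay := by
    obtain ⟨C, hC1, hC⟩ := exists_bounds hβ hη1 hη hreg b
    obtain ⟨P, hP1, hP⟩ := hp.exists_norm_laplace_le (max η B)
    refine ⟨P * C * (16 * C ^ 4 * (2 * C) ^ (n - 4)) * (C * ((2 * C) * (2 * C)) ^ n) ^ k,
      fun s h1 h2 => ?_⟩
    obtain ⟨b1, b2, b3, b4⟩ := hC s h1
    have hs : 1 / 2 ≤ ‖1 + s‖ := by
      refine le_trans ?_ (Complex.re_le_norm _)
      simp
      linarith
    have hu : ‖mult α β d s‖ ≤ 2 * C := by nlinarith [norm_nonneg (mult α β d s)]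
    have hw : ‖mult α β (-d) s‖ ≤ 2 * C := by nlinarith [norm_nonneg (mult α β (-d) s)]
    have hPs := hP s (abs_le.2 ⟨by linarith [le_max_left η B], by linarith [le_max_right η B]⟩)
    have h4 := pow_mul_sq_le (by linarith) b1 hn
    rw [pulseTerm, loop, norm_mul, norm_mul, norm_mul, norm_pow, norm_pow, norm_neg, norm_mul,
      norm_pow, norm_mul]
    calc ‖laplace p s‖ * ‖gain α β d b s‖ * ‖mult α β d s‖ ^ n
          * (‖reflCoeff α β d b s‖ * (‖mult α β d s‖ * ‖mult α β (-d) s‖) ^ n) ^ k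
          * (1 + s.im ^ 2) ^ 2
        = ‖laplace p s‖ * ‖gain α β d b s‖ * (‖mult α β d s‖ ^ n * (1 + s.im ^ 2) ^ 2)
          * (‖reflCoeff α β d b s‖ * (‖mult α β d s‖ * ‖mult α β (-d) s‖) ^ n) ^ k := by ring
      _ ≤ _ := by gcongr

/-- The signal after `k` reflections is concentrated near its arrival time. -/
lemma exists_pulse_bound (hα : 0 < α) (hβ : 0 < β) (hη0 : 0 < η) (hη1 : η ≤ 1 / 2)
    (hη : η ≤ β / 2) (hreg : ∀ s : ℂ, -η ≤ s.re → Regular α β d s) (hp : IsUnitPulse p)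
    (b : LastAgent) :
    ∃ n₀ : ℕ, 4 ≤ n₀ ∧ ∀ k : ℕ, ∃ C : ℝ, 0 ≤ C ∧ ∀ n : ℕ, n₀ ≤ n → ∀ t : ℝ,
      ‖invLaplace (pulseTerm α β d b p n k) 0 t‖
        ≤ C / √n * Real.exp (-(|t - n * arrival α d k| / √n)) := by
  obtain ⟨σ₁, hσ₁, C₁, κ, hC₁, hκ, h1⟩ := exists_pow_bound hα hβ hη0 hη hreg
  obtain ⟨σ₂, hσ₂, C₂, κ₂, hC₂, hκ₂, h2⟩ :=
    exists_pow_bound (d := -d) hα hβ hη0 hη fun s hs => (hreg s hs).neg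
  obtain ⟨C, hC1, hC⟩ := exists_bounds hβ hη1 hη hreg b
  obtain ⟨P, hP1, hP⟩ := hp.exists_norm_laplace_le 1
  set τ := min (min σ₁ σ₂) η with hτ
  have hτ0 : 0 < τ := by positivity
  obtain ⟨n₀, hn₀⟩ := exists_nat_ge (1 / τ ^ 2)
  refine ⟨max 4 n₀, le_max_left _ _, fun k => ?_⟩
  set D := P * C * C₁ * (C * (C₁ * C₂)) ^ k with hD
  refine ⟨D / √κ, by positivity, fun n hn t => ?_⟩
  have hn4 : 4 ≤ n := (le_max_left _ _).trans hn
  have hnpos : (0 : ℝ) < n := by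
    have : 0 < n := by omega
    exact_mod_cast this
  have hsq : 0 < √(n : ℝ) := Real.sqrt_pos.2 hnpos
  have hsqτ : 1 / √(n : ℝ) ≤ τ := by
    have e1 : 1 / τ ^ 2 ≤ n := hn₀.trans (by exact_mod_cast (le_max_right _ _).trans hn)
    rw [div_le_iff₀ hsq]
    rw [div_le_iff₀ (by positivity)] at e1
    have e2 : (1 : ℝ) ≤ (τ * √n) ^ 2 := by
      rw [mul_pow, Real.sq_sqrt hnpos.le]
      linarith
    nlinarith [mul_pos hτ0 hsq]
  have hdecay : StripDecay (pulseTerm α β d b p n k) (-η) η :=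
    stripDecay_pulseTerm hβ hη0 hη1 hη hreg hp hn4 k η
  -- The line is moved by `1 / √n`, the scale at which the quadratic error `n * σ ^ 2` still costs
  -- only a constant.
  have hline : ∀ σ : ℝ, |σ| = 1 / √n → ‖invLaplace (pulseTerm α β d b p n k) 0 t‖
      ≤ D / √κ / √n * Real.exp (σ * (t - n * arrival α d k)) := by
    intro σ hσ
    have hστ : |σ| ≤ τ := hσ.trans_le hsqτ
    have hσ1 : |σ| ≤ σ₁ := hστ.trans ((min_le_left _ _).trans (min_le_left _ _))
    have hσ2 : |σ| ≤ σ₂ := hστ.trans ((min_le_left _ _).trans (min_le_right _ _))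
    have hση : |σ| ≤ η := hστ.trans (min_le_right _ _)
    have hnσ : n * σ ^ 2 ≤ 1 := by
      rw [← sq_abs, hσ, div_pow, Real.sq_sqrt hnpos.le]
      field_simp
      norm_num
    have hshift : invLaplace (pulseTerm α β d b p n k) 0 t
        = invLaplace (pulseTerm α β d b p n k) σ t := by
      rcases le_total 0 σ with h0 | h0
      · exact (hdecay.mono (a' := 0) (b' := σ) (by linarith)
          ((le_abs_self _).trans hση)).invLaplace_eq h0 t
      · exact ((hdecay.mono (a' := σ) (b' := 0) (by linarith [neg_abs_le σ])
          hη0.le).invLaplace_eq h0 t).symm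
    rw [hshift]
    have hmain : ∀ s : ℂ, s.re = σ → ‖pulseTerm α β d b p n k s‖ * (1 + κ * n * s.im ^ 2)
        ≤ D * Real.exp (-(σ * (n * arrival α d k))) := by
      intro s hs
      obtain ⟨-, -, b3, b4⟩ := hC s (by rw [hs]; linarith [neg_abs_le σ])
      have e1 := h1 n (by omega) s (by rwa [hs]) (by rwa [hs])
      have e2 := h2 n (by omega) s (by rwa [hs]) (by rwa [hs])
      rw [hs] at e1 e2
      set E₁ := Real.exp (-(n * σ / speed α d)) with hE₁
      set E₂ := Real.exp (-(n * σ / speed α (-d))) with hE₂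
      have e1' : ‖mult α β d s‖ ^ n ≤ C₁ * E₁ := by
        refine le_trans (le_mul_of_one_le_right (by positivity) ?_) e1
        have : 0 ≤ κ * n * s.im ^ 2 := by positivity
        linarith
      have e2' : ‖mult α β (-d) s‖ ^ n ≤ C₂ * E₂ := by
        refine le_trans (le_mul_of_one_le_right (by positivity) ?_) e2
        have : 0 ≤ κ₂ * n * s.im ^ 2 := by positivity
        linarith
      have e3 := hP s (by rw [hs]; linarith)
      rw [pulseTerm, loop, norm_mul, norm_mul, norm_mul, norm_pow, norm_pow, norm_neg, norm_mul,
        norm_pow, norm_mul, mul_pow ‖mult α β d s‖]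
      -- The leading factor `‖mult‖ ^ n` alone supplies the decay in `s.im`; the powers from the
      -- reflections contribute only their exponentials.
      calc ‖laplace p s‖ * ‖gain α β d b s‖ * ‖mult α β d s‖ ^ n
            * (‖reflCoeff α β d b s‖ * (‖mult α β d s‖ ^ n * ‖mult α β (-d) s‖ ^ n)) ^ k
            * (1 + κ * n * s.im ^ 2)
          = ‖laplace p s‖ * ‖gain α β d b s‖ * (‖mult α β d s‖ ^ n * (1 + κ * n * s.im ^ 2))
            * (‖reflCoeff α β d b s‖ * (‖mult α β d s‖ ^ n * ‖mult α β (-d) s‖ ^ n)) ^ k := by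
            ring
        _ ≤ P * C * (C₁ * E₁) * (C * ((C₁ * E₁) * (C₂ * E₂))) ^ k := by gcongr
        _ = D * (E₁ * (E₁ * E₂) ^ k) := by rw [hD]; ring
        _ = D * Real.exp (-(σ * (n * arrival α d k))) := by
            rw [hE₁, hE₂, ← Real.exp_add, ← Real.exp_nat_mul, ← Real.exp_add]
            congr 2
            rw [arrival]
            ring
    refine (norm_invLaplace_le (by positivity) hmain t).trans (le_of_eq ?_)
    rw [Real.sqrt_mul hκ.le, mul_sub, sub_eq_add_neg, Real.exp_add]
    field_simp
  -- The sign of `σ` is chosen so that the exponential decays away from the arrival time.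
  rcases le_total 0 (t - n * arrival α d k) with h0 | h0
  · refine (hline (-(1 / √n)) (by rw [abs_neg, abs_of_pos (by positivity)])).trans (le_of_eq ?_)
    rw [abs_of_nonneg h0]
    congr 2
    ring
  · refine (hline (1 / √n) (abs_of_pos (by positivity))).trans (le_of_eq ?_)
    rw [abs_of_nonpos h0]
    congr 2
    ring

end Dispersion

/-! ### Finite expansion of the orbit -/

namespace Dispersion

variable {α β d η : ℝ} {s : ℂ} {p : ℝ → ℝ} {b : LastAgent}

/-- An exact finite geometric sum is needed because `loop` equals `|c₋| / c₊` at the origin, which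
may be one or larger. -/
lemma sum_pulseTerm (n m : ℕ) (h : 1 + loop α β d b n s ≠ 0) :
    (∑ k ∈ Finset.range m, pulseTerm α β d b p n k s)
        + pulseTerm α β d b p n m s / (1 + loop α β d b n s)
      = laplace p s * gain α β d b s * mult α β d s ^ n / (1 + loop α β d b n s) := by
  have h1 := geom_sum_mul_neg (-loop α β d b n s) m
  rw [sub_neg_eq_add] at h1
  simp only [pulseTerm]
  rw [← Finset.mul_sum, eq_div_iff h, add_mul, div_mul_cancel₀ _ h]
  linear_combination laplace p s * gain α β d b s * mult α β d s ^ n * h1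

lemma norm_mult_le_of_re {u : ℂ} {C : ℝ} (hC : ‖u‖ * ‖1 + s‖ ≤ C) (hC1 : 1 ≤ C)
    (hs : Real.exp 1 * C ≤ s.re) : ‖u‖ ≤ Real.exp (-1) := by
  have h1 : Real.exp 1 * C ≤ ‖1 + s‖ := by
    refine le_trans ?_ (Complex.re_le_norm _)
    simp
    linarith
  have h2 : ‖u‖ * (Real.exp 1 * C) ≤ C := (mul_le_mul_of_nonneg_left h1 (norm_nonneg _)).trans hC
  have h3 : ‖u‖ * Real.exp 1 ≤ 1 := by
    refine le_of_mul_le_mul_right ?_ (show 0 < C by linarith)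
    linarith
  rw [Real.exp_neg, ← one_div, le_div_iff₀ (Real.exp_pos 1)]
  exact h3

lemma one_add_sq_le (hs : 0 ≤ s.re) : 1 + s.im ^ 2 ≤ ‖1 + s‖ ^ 2 := by
  rw [Complex.sq_norm, Complex.normSq_apply]
  simp
  nlinarith [sq_nonneg s.im]

end Dispersion

open Dispersion in
/-- The orbit of the last agent is a finite sum of reflected signals up to a remainder that is
small until late times. -/
lemma exists_expansion {F : Flock} (hF : F.Normalized) (b : LastAgent) {p : ℝ → ℝ}
    (hp : IsUnitPulse p) {η : ℝ} (hη0 : 0 < η) (hη1 : η ≤ 1 / 2) (hη : η ≤ -F.gv / 2)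
    (hreg : ∀ s : ℂ, -η ≤ s.re → Regular (-F.gx) (-F.gv) F.drift s) :
    ∃ σ : ℝ, 0 < σ ∧ ∃ n₀ : ℕ, 4 ≤ n₀ ∧ ∀ m : ℕ, ∃ D : ℝ, 0 ≤ D ∧ ∀ n : ℕ, n₀ ≤ n →
      ∀ (v₀ : ℝ) (z : ℕ → ℝ → ℝ), IsPulseMotion F b p v₀ (n + 1) z → ∀ t : ℝ,
      ‖(z (n + 1) t : ℂ) - v₀ * ∑ k ∈ Finset.range m,
          invLaplace (pulseTerm (-F.gx) (-F.gv) F.drift b p n k) 0 t‖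
        ≤ |v₀| * D * Real.exp (σ * t - 2 * n * m) := by
  have hβ : 0 < -F.gv := by linarith [hF.gv_neg]
  obtain ⟨C, hC1, hC⟩ := exists_bounds hβ hη1 hη hreg b
  have hA := F.growthRate_pos b
  -- The first entry makes the transform of every orbit converge; the second brings both multipliers
  -- below `1 / e`.
  set σ := max (F.growthRate b + 1) (Real.exp 1 * C) with hσ
  have hσA : F.growthRate b < σ := lt_of_lt_of_le (by linarith) (le_max_left _ _)
  have hσ0 : 0 < σ := hA.trans hσA
  obtain ⟨P, hP1, hP⟩ := hp.exists_norm_laplace_le σ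
  obtain ⟨n₀, hn₀⟩ := exists_nat_ge C
  refine ⟨σ, hσ0, max 4 n₀, le_max_left _ _, fun m => ⟨2 * P * C ^ 3 * C ^ m, by positivity, ?_⟩⟩
  intro n hn v₀ z hz t
  have hn4 : 4 ≤ n := (le_max_left _ _).trans hn
  have hnC : C ≤ n := hn₀.trans (by exact_mod_cast (le_max_right _ _).trans hn)
  -- estimates on the line
  have hu : ∀ s : ℂ, s.re = σ → ‖mult (-F.gx) (-F.gv) F.drift s‖ ≤ Real.exp (-1) := fun s hs =>
    norm_mult_le_of_re (hC s (by linarith)).1 hC1 (by rw [hs]; exact le_max_right _ _)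
  have hw : ∀ s : ℂ, s.re = σ → ‖mult (-F.gx) (-F.gv) (-F.drift) s‖ ≤ Real.exp (-1) := fun s hs =>
    norm_mult_le_of_re (hC s (by linarith)).2.1 hC1 (by rw [hs]; exact le_max_right _ _)
  have hloop : ∀ s : ℂ, s.re = σ →
      ‖loop (-F.gx) (-F.gv) F.drift b n s‖ ≤ C * Real.exp (-(2 * n)) := by
    intro s hs
    rw [loop, norm_mul, norm_pow, norm_mul]
    calc _ ≤ C * (Real.exp (-1) * Real.exp (-1)) ^ n := by
          gcongr
          · exact (hC s (by linarith)).2.2.2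
          · exact hu s hs
          · exact hw s hs
      _ = C * Real.exp (-(2 * n)) := by
          rw [← Real.exp_add, ← Real.exp_nat_mul]
          ring_nf
  have hhalf : C * Real.exp (-(2 * n)) ≤ 1 / 2 := by
    rw [Real.exp_neg, ← div_eq_mul_inv, div_le_iff₀ (Real.exp_pos _)]
    linarith [Real.add_one_le_exp (2 * (n : ℝ))]
  have hone : ∀ s : ℂ, s.re = σ → 1 / 2 ≤ ‖1 + loop (-F.gx) (-F.gv) F.drift b n s‖ := by
    intro s hs
    have h1 := norm_sub_norm_le 1 (-loop (-F.gx) (-F.gv) F.drift b n s)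
    rw [sub_neg_eq_add, norm_one, norm_neg] at h1
    linarith [hloop s hs]
  have hne : ∀ s : ℂ, s.re = σ → 1 + loop (-F.gx) (-F.gv) F.drift b n s ≠ 0 := by
    intro s hs h0
    have := hone s hs
    rw [h0, norm_zero] at this
    linarith
  set T := fun k => pulseTerm (-F.gx) (-F.gv) F.drift b p n k with hT
  set R : ℂ → ℂ := fun s => T m s / (1 + loop (-F.gx) (-F.gv) F.drift b n s) with hR
  have hTdec : ∀ k, StripDecay (T k) (-η) σ := fun k =>
    stripDecay_pulseTerm hβ hη0 hη1 hη hreg hp hn4 k σ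
  have hRT : ∀ s : ℂ, s.re = σ → ‖R s‖ ≤ 2 * ‖T m s‖ := by
    intro s hs
    rw [hR, norm_div, div_le_iff₀ (by linarith [hone s hs])]
    have := mul_le_mul_of_nonneg_left (hone s hs) (norm_nonneg (T m s))
    linarith
  -- A strip of width zero: `1 + loop` may vanish to the left, so only the individual terms, not the
  -- remainder, are moved to the imaginary axis.
  have hRdec : StripDecay R σ σ := by
    refine ⟨fun s h1 h2 => ?_, ?_⟩
    · have hs : s.re = σ := le_antisymm h2 h1
      exact ((hTdec m).diff s (by linarith) h2).div
        (((hreg s (by linarith)).differentiableAt_loop b n).const_add 1) (hne s hs)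
    · obtain ⟨E, hE⟩ := (hTdec m).decay
      refine ⟨2 * E, fun s h1 h2 => ?_⟩
      have := hE s (by linarith) h2
      have h3 := mul_le_mul_of_nonneg_right (hRT s (le_antisymm h2 h1))
        (show 0 ≤ (1 + s.im ^ 2) ^ 2 by positivity)
      linarith
  -- the transform of the orbit
  have hlap : ∀ s : ℂ, s.re = σ → laplace (z (n + 1)) s
      = v₀ * ((∑ k ∈ Finset.range m, T k s) + R s) := by
    intro s hs
    have h1 := hz.transfer hF hp (s := s) (by rw [hs]; exact hσA) (hreg s (by linarith))
    change laplace (z (n + 1)) s * (1 + loop (-F.gx) (-F.gv) F.drift b n s) = _ at h1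
    rw [hT, hR, sum_pulseTerm n m (hne s hs), mul_div_assoc', eq_div_iff (hne s hs), h1]
    ring
  have hlate := (hz.lateExp hp).1 (n + 1) le_rfl
  have hint : Integrable fun ξ : ℝ => laplace (z (n + 1)) (linePoint σ ξ) := by
    simp only [hlap _ (linePoint_re σ _)]
    exact ((integrable_finsetSum _ fun k _ => (hTdec k).integrable_line (by linarith) le_rfl).add
      (hRdec.integrable_line le_rfl le_rfl)).const_mul _
  have hinv := hlate.invLaplace_laplace hσA hint t
  have hexp : (z (n + 1) t : ℂ) = v₀ * ((∑ k ∈ Finset.range m, invLaplace (T k) σ t)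
      + invLaplace R σ t) := by
    rw [← hinv]
    simp only [invLaplace]
    rw [← integral_finsetSum _ fun k _ => (hTdec k).integrable_exp_line (by linarith) le_rfl t,
      ← integral_add (integrable_finsetSum _ fun k _ =>
        (hTdec k).integrable_exp_line (by linarith) le_rfl t)
        (hRdec.integrable_exp_line le_rfl le_rfl t), ← integral_const_mul]
    congr 1
    ext ξ
    rw [hlap _ (linePoint_re σ ξ), ← Finset.mul_sum]
    ring
  have hshift : ∀ k, invLaplace (T k) 0 t = invLaplace (T k) σ t := fun k =>
    ((hTdec k).mono (by linarith) le_rfl).invLaplace_eq hσ0.le t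
  have hsum : ∑ k ∈ Finset.range m, invLaplace (pulseTerm (-F.gx) (-F.gv) F.drift b p n k) 0 t
      = ∑ k ∈ Finset.range m, invLaplace (T k) σ t := Finset.sum_congr rfl fun k _ => hshift k
  rw [hsum, hexp, mul_add, add_sub_cancel_left, norm_mul, Complex.norm_real, Real.norm_eq_abs, mul_assoc]
  gcongr
  have hRb : ∀ s : ℂ, s.re = σ → ‖R s‖ * (1 + 1 * s.im ^ 2)
      ≤ 2 * P * C ^ 3 * C ^ m * Real.exp (-(2 * n * m)) := by
    intro s hs
    obtain ⟨b1, -, b3, -⟩ := hC s (by linarith)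
    have hu1 : ‖mult (-F.gx) (-F.gv) F.drift s‖ ≤ 1 :=
      (hu s hs).trans (Real.exp_le_one_iff.2 (by norm_num))
    have e1 : ‖mult (-F.gx) (-F.gv) F.drift s‖ ^ n * (1 + 1 * s.im ^ 2) ≤ C ^ 2 := by
      calc _ ≤ ‖mult (-F.gx) (-F.gv) F.drift s‖ ^ 2 * ‖1 + s‖ ^ 2 := by
            refine mul_le_mul (pow_le_pow_of_le_one (norm_nonneg _) hu1 (by omega)) ?_
              (by positivity) (by positivity)
            rw [one_mul]
            exact one_add_sq_le (by linarith)
        _ = (‖mult (-F.gx) (-F.gv) F.drift s‖ * ‖1 + s‖) ^ 2 := by ring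
        _ ≤ C ^ 2 := by gcongr
    have e2 := hP s (by rw [hs, abs_of_pos hσ0])
    calc ‖R s‖ * (1 + 1 * s.im ^ 2) ≤ 2 * ‖T m s‖ * (1 + 1 * s.im ^ 2) := by
          gcongr
          exact hRT s hs
      _ = 2 * (‖laplace p s‖ * ‖gain (-F.gx) (-F.gv) F.drift b s‖
          * (‖mult (-F.gx) (-F.gv) F.drift s‖ ^ n * (1 + 1 * s.im ^ 2))
          * ‖loop (-F.gx) (-F.gv) F.drift b n s‖ ^ m) := by
          rw [hT]
          simp only [pulseTerm]
          rw [norm_mul, norm_mul, norm_mul, norm_pow, norm_pow, norm_neg]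
          ring
      _ ≤ 2 * (P * C * C ^ 2 * (C * Real.exp (-(2 * n))) ^ m) := by
          gcongr
          exact hloop s hs
      _ = 2 * P * C ^ 3 * C ^ m * Real.exp (-(2 * n * m)) := by
          rw [mul_pow, ← Real.exp_nat_mul]
          ring_nf
  refine (norm_invLaplace_le one_pos hRb t).trans (le_of_eq ?_)
  rw [Real.sqrt_one, div_one, sub_eq_add_neg, Real.exp_add]
  ring

/-! ### Approximation of concentrated functions by unit pulses -/

/-- A fixed bump function of integral one. -/
noncomputable def unitBump : ContDiffBump (0 : ℝ) := ⟨1 / 2, 1, by norm_num, by norm_num⟩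

lemma isUnitPulse_unitBump : IsUnitPulse (unitBump.normed volume) where
  differentiable := (unitBump.contDiff_normed (n := 1)).differentiable (by norm_num)
  compactSupport := unitBump.hasCompactSupport_normed
  integral_eq_one := unitBump.integral_normed

lemma tsupport_unitBump_subset : tsupport (unitBump.normed volume) ⊆ Icc (-1) 1 := by
  rw [unitBump.tsupport_normed_eq, Real.closedBall_eq_Icc]
  simp [unitBump]

/-- An integrable function agrees with a multiple of a unit pulse, up to an error that is controlled
by its tails. -/
lemma exists_unitPulse_near {φ : ℝ → ℝ} (hφ : Differentiable ℝ φ) (hint : Integrable φ) {m : ℝ}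
    (hm : m ≠ 0) (hφm : ∫ τ, φ τ = m) {ρ : ℝ} (hρ : 0 < ρ) :
    ∃ f, IsUnitPulse f ∧ tsupport f ⊆ Icc (-(2 * ρ + 1)) (2 * ρ + 1) ∧
      ∀ τ, |φ τ - m * f τ| ≤ {τ | ρ ≤ |τ|}.indicator (fun τ => |φ τ|) τ
        + (∫ τ, {τ | ρ ≤ |τ|}.indicator (fun τ => |φ τ|) τ) * unitBump.normed volume τ := by
  set χ : ContDiffBump (0 : ℝ) := ⟨ρ, 2 * ρ, hρ, by linarith⟩ with hχ
  set β := unitBump.normed (volume : Measure ℝ) with hβ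
  have hβ1 := isUnitPulse_unitBump
  have hχd : Differentiable ℝ χ := (χ.contDiff (n := 1)).differentiable (by norm_num)
  have hχs : tsupport χ = Icc (-(2 * ρ)) (2 * ρ) := by
    rw [χ.tsupport_eq, Real.closedBall_eq_Icc]
    simp [hχ]
  have hintχ : Integrable fun τ => φ τ * χ τ :=
    Continuous.integrable_of_hasCompactSupport (hφ.continuous.mul hχd.continuous)
      χ.hasCompactSupport.mul_left
  have hintβ : Integrable β :=
    hβ1.differentiable.continuous.integrable_of_hasCompactSupport hβ1.compactSupport
  set I := ∫ τ, φ τ * χ τ with hI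
  -- The cutoff loses the mass `m - I`, at most the integral of the tails; the fixed bump restores
  -- integral one.
  set f : ℝ → ℝ := fun τ => φ τ * χ τ / m + (1 - I / m) * β τ with hf
  have hsupp : tsupport f ⊆ Icc (-(2 * ρ + 1)) (2 * ρ + 1) := by
    refine closure_minimal (fun τ hτ => ?_) isClosed_Icc
    by_contra hn
    refine hτ ?_
    have h1 : χ τ = 0 := by
      refine image_eq_zero_of_notMem_tsupport fun h => hn ?_
      rw [hχs] at h
      exact ⟨by linarith [h.1], by linarith [h.2]⟩
    have h2 : β τ = 0 := by
      refine image_eq_zero_of_notMem_tsupport fun h => hn ?_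
      have h := tsupport_unitBump_subset h
      exact ⟨by linarith [h.1], by linarith [h.2]⟩
    simp [hf, h1, h2]
  refine ⟨f, ⟨?_, ?_, ?_⟩, hsupp, fun τ => ?_⟩
  · exact ((hφ.mul hχd).div_const m).add (hβ1.differentiable.const_mul _)
  · exact HasCompactSupport.of_support_subset_isCompact isCompact_Icc
      ((subset_tsupport f).trans hsupp)
  · rw [hf, integral_add (hintχ.div_const m) (hintβ.const_mul _), integral_div, integral_const_mul,
      hβ1.integral_eq_one, ← hI]
    ring
  · have hmeas : MeasurableSet {τ : ℝ | ρ ≤ |τ|} :=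
      (isClosed_le continuous_const continuous_abs).measurableSet
    have htail : ∀ τ, |φ τ * (1 - χ τ)| ≤ {τ | ρ ≤ |τ|}.indicator (fun τ => |φ τ|) τ := by
      intro τ
      by_cases h : ρ ≤ |τ|
      · rw [indicator_of_mem (show τ ∈ {τ : ℝ | ρ ≤ |τ|} from h), abs_mul]
        refine mul_le_of_le_one_right (abs_nonneg _) (abs_le.2 ⟨?_, ?_⟩)
        · linarith [χ.le_one (x := τ)]
        · linarith [χ.nonneg (x := τ)]
      · have : χ τ = 1 := χ.one_of_mem_closedBall (by
          rw [mem_closedBall_zero_iff, Real.norm_eq_abs]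
          exact (not_le.1 h).le)
        rw [this, indicator_of_notMem (show τ ∉ {τ : ℝ | ρ ≤ |τ|} from h)]
        simp
    have hmI : |m - I| ≤ ∫ τ, {τ | ρ ≤ |τ|}.indicator (fun τ => |φ τ|) τ := by
      have h1 : m - I = ∫ τ, φ τ * (1 - χ τ) := by
        rw [← hφm, hI, ← integral_sub hint hintχ]
        congr 1
        ext τ
        ring
      rw [h1]
      exact norm_integral_le_of_norm_le (f := fun τ => φ τ * (1 - χ τ)) (hint.abs.indicator hmeas)
        (Eventually.of_forall htail)
    have hβ0 : 0 ≤ β τ := unitBump.nonneg_normed τ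
    calc |φ τ - m * f τ| = |φ τ * (1 - χ τ) - (m - I) * β τ| := by
          congr 1
          simp only [hf]
          field_simp
          ring
      _ ≤ |φ τ * (1 - χ τ)| + |(m - I) * β τ| := abs_sub _ _
      _ ≤ _ := by
          rw [abs_mul (m - I), abs_of_nonneg hβ0]
          exact add_le_add (htail τ) (mul_le_mul_of_nonneg_right hmI hβ0)

lemma exp_neg_le_two_div {x : ℝ} (hx : 0 ≤ x) : Real.exp (-x) ≤ 2 * (1 + x ^ 2)⁻¹ := by
  rw [Real.exp_neg, ← div_eq_mul_inv, inv_le_comm₀ (Real.exp_pos x) (by positivity), inv_div]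
  linarith [Real.quadratic_le_exp_of_nonneg hx]

/-- The tails of an exponentially concentrated function. -/
lemma tail_bound {φ : ℝ → ℝ} {C T w ρ : ℝ} (hC : 0 ≤ C) (hw : 0 < w) (hT : 0 ≤ T)
    (hφ : ∀ τ, |φ τ| ≤ C / w * Real.exp (-(|τ + T| / w))) (hρ : 2 * T ≤ ρ) :
    (∫ τ, {τ | ρ ≤ |τ|}.indicator (fun τ => |φ τ|) τ)
      ≤ 8 * Real.pi * C * Real.exp (-(ρ / (4 * w))) := by
  have hκ : 0 < 1 / (4 * w) ^ 2 := by positivity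
  have hb : ∀ τ, {τ | ρ ≤ |τ|}.indicator (fun τ => |φ τ|) τ
      ≤ 2 * (C / w) * Real.exp (-(ρ / (4 * w))) * (1 + 1 / (4 * w) ^ 2 * τ ^ 2)⁻¹ := by
    intro τ
    by_cases h : ρ ≤ |τ|
    · rw [indicator_of_mem (show τ ∈ {τ : ℝ | ρ ≤ |τ|} from h)]
      -- Half of the resulting exponent `|τ| / (2 * w)` yields the factor `exp (-(ρ / (4 * w)))`,
      -- the other half keeps the tail integrable.
      have h1 : |τ| / 2 ≤ |τ + T| := by
        have := abs_sub_abs_le_abs_sub τ (-T)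
        rw [abs_neg, abs_of_nonneg hT, sub_neg_eq_add] at this
        linarith
      have h2 : Real.exp (-(|τ + T| / w))
          ≤ Real.exp (-(ρ / (4 * w))) * Real.exp (-(|τ| / (4 * w))) := by
        rw [← Real.exp_add, Real.exp_le_exp]
        have h3 : ρ / (4 * w) + |τ| / (4 * w) ≤ |τ + T| / w := by
          rw [← add_div, div_le_div_iff₀ (by positivity) hw]
          nlinarith
        linarith
      have h3 := exp_neg_le_two_div (show 0 ≤ |τ| / (4 * w) by positivity)
      rw [div_pow, sq_abs] at h3
      calc |φ τ| ≤ C / w * Real.exp (-(|τ + T| / w)) := hφ τ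
        _ ≤ C / w * (Real.exp (-(ρ / (4 * w))) * (2 * (1 + τ ^ 2 / (4 * w) ^ 2)⁻¹)) := by
            gcongr
            exact h2.trans (by gcongr)
        _ = _ := by
            rw [one_div_mul_eq_div]
            ring
    · rw [indicator_of_notMem (show τ ∉ {τ : ℝ | ρ ≤ |τ|} from h)]
      positivity
  calc _ ≤ ∫ τ, 2 * (C / w) * Real.exp (-(ρ / (4 * w))) * (1 + 1 / (4 * w) ^ 2 * τ ^ 2)⁻¹ := by
        refine integral_mono_of_nonneg (Eventually.of_forall fun τ => ?_)
          ((integrable_inv_one_add_mul_sq hκ).const_mul _) (Eventually.of_forall hb)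
        exact indicator_nonneg (fun _ _ => abs_nonneg _) τ
    _ = _ := by
        rw [integral_const_mul, integral_inv_one_add_mul_sq hκ, Real.sqrt_div zero_le_one,
          Real.sqrt_one, Real.sqrt_sq (by positivity)]
        field_simp
        ring

lemma integrable_of_exp_bound {φ : ℝ → ℂ} (hc : Continuous φ) {C T w : ℝ} (hC : 0 ≤ C) (hw : 0 < w)
    (hφ : ∀ τ, ‖φ τ‖ ≤ C * Real.exp (-(|τ - T| / w))) : Integrable φ := by
  have hκ : 0 < 1 / w ^ 2 := by positivity
  refine Integrable.mono' (((integrable_inv_one_add_mul_sq hκ).comp_sub_right T).const_mul (C * 2))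
    hc.aestronglyMeasurable (Eventually.of_forall fun τ => (hφ τ).trans ?_)
  rw [mul_assoc]
  gcongr
  refine (exp_neg_le_two_div (by positivity)).trans (le_of_eq ?_)
  rw [div_pow, sq_abs, one_div_mul_eq_div]

/-! ### Pulse shapes of the reflected signals -/

namespace Dispersion

variable {α β d η : ℝ} {s : ℂ} {p : ℝ → ℝ} {b : LastAgent}

lemma arrival_nonneg (hα : 0 < α) (d : ℝ) (k : ℕ) : 0 ≤ arrival α d k := by
  have h1 := speed_pos (d := d) hα
  have h2 := speed_pos (d := -d) hα
  unfold arrival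
  positivity

lemma pulseTerm_zero (hα : 0 < α) (h : Regular α β d 0) (hp : IsUnitPulse p) (n k : ℕ) :
    pulseTerm α β d b p n k 0
      = ((1 + speed α (-d) / speed α d) * (-(speed α (-d) / speed α d)) ^ k : ℝ) := by
  rw [pulseTerm, loop, hp.laplace_zero, gain_zero hα h, reflCoeff_zero hα h, mult_zero, mult_zero]
  simp

/-- The radius of the pulses. -/
noncomputable def radius (N : ℕ) : ℝ := 2 * (N : ℝ) ^ (3 / 4 : ℝ) + 1

lemma tendsto_radius_div : Tendsto (fun N : ℕ => radius N / N) atTop (𝓝 0) := by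
  have h1 : Tendsto (fun N : ℕ => 2 * (N : ℝ) ^ (-(1 / 4) : ℝ) + (N : ℝ)⁻¹) atTop
      (𝓝 (2 * 0 + 0)) :=
    (((tendsto_rpow_neg_atTop (by norm_num : (0 : ℝ) < 1 / 4)).comp
      tendsto_natCast_atTop_atTop).const_mul 2).add tendsto_inv_atTop_nhds_zero_nat
  rw [mul_zero, add_zero] at h1
  refine h1.congr' ?_
  filter_upwards [eventually_gt_atTop 0] with N hN
  have hN' : (0 : ℝ) < N := by exact_mod_cast hN
  have h2 : (N : ℝ) ^ (3 / 4 : ℝ) / N = (N : ℝ) ^ (-(1 / 4) : ℝ) := by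
    rw [← Real.rpow_sub_one hN'.ne']
    norm_num
  rw [radius, add_div, mul_div_assoc, h2, inv_eq_one_div]

/-- The signal after `k` reflections is a multiple of a unit pulse, up to small errors. -/
lemma exists_pulses (hα : 0 < α) (hβ : 0 < β) (hη0 : 0 < η) (hη1 : η ≤ 1 / 2)
    (hη : η ≤ β / 2) (hreg : ∀ s : ℂ, -η ≤ s.re → Regular α β d s) (hp : IsUnitPulse p)
    (b : LastAgent) (k : ℕ) :
    ∃ (f : ℕ → ℝ → ℝ) (ε : ℕ → ℝ), (∀ N, IsUnitPulse (f N)) ∧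
      (∀ N, tsupport (f N) ⊆ Icc (-radius N) (radius N)) ∧ Tendsto ε atTop (𝓝 0) ∧
      ∀ᶠ N in atTop, ∃ g : ℝ → ℝ, Integrable g ∧ (∫ τ, g τ) ≤ ε N ∧ ∀ τ, g τ ≤ ε N ∧
        |(invLaplace (pulseTerm α β d b p (N - 1) k) 0 (τ + N * arrival α d k)).re
          - (1 + speed α (-d) / speed α d) * (-(speed α (-d) / speed α d)) ^ k * f N τ| ≤ g τ := by
  obtain ⟨n₀, hn₀, hpulse⟩ := exists_pulse_bound hα hβ hη0 hη1 hη hreg hp b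
  obtain ⟨C, hC0, hC⟩ := hpulse k
  have hs1 := speed_pos (d := d) hα
  have hs2 := speed_pos (d := -d) hα
  set m := (1 + speed α (-d) / speed α d) * (-(speed α (-d) / speed α d)) ^ k with hm
  have hm0 : m ≠ 0 := by
    refine mul_ne_zero (by positivity) (pow_ne_zero _ (neg_ne_zero.2 (by positivity)))
  set T := arrival α d k with hT
  have hT0 : 0 ≤ T := arrival_nonneg hα d k
  set φ : ℕ → ℝ → ℝ := fun N τ =>
    (invLaplace (pulseTerm α β d b p (N - 1) k) 0 (τ + N * T)).re with hφ
  have hdecay : ∀ N, n₀ < N → StripDecay (pulseTerm α β d b p (N - 1) k) (-η) 1 := fun N hN =>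
    stripDecay_pulseTerm hβ hη0 hη1 hη hreg hp (by omega) k 1
  have hdiff : ∀ N, n₀ < N → Differentiable ℝ (φ N) := fun N hN =>
    Complex.reCLM.differentiable.comp
      (((hdecay N hN).differentiable_invLaplace (σ := 0) (by linarith) zero_le_one).comp
        (differentiable_id.add_const _))
  have hwpos : ∀ N, n₀ < N → 0 < √((N - 1 : ℕ) : ℝ) := fun N hN => by
    refine Real.sqrt_pos.2 ?_
    have : 0 < N - 1 := by omega
    exact_mod_cast this
  have hψint : ∀ N, n₀ < N → Integrable (invLaplace (pulseTerm α β d b p (N - 1) k) 0) :=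
    fun N hN => integrable_of_exp_bound
      ((hdecay N hN).differentiable_invLaplace (by linarith) zero_le_one).continuous
      (by have := hwpos N hN; positivity) (hwpos N hN) (hC (N - 1) (by omega))
  have hφint : ∀ N, n₀ < N → Integrable (φ N) := fun N hN =>
    ((hψint N hN).comp_add_right _).re
  have hφm : ∀ N, n₀ < N → ∫ τ, φ N τ = m := by
    intro N hN
    have h1 := (hdecay N hN).integral_invLaplace_zero (by linarith) zero_le_one (hψint N hN)
    rw [pulseTerm_zero hα (hreg 0 (by simpa using hη0.le)) hp] at h1
    have h2 : ∫ τ, φ N τ = ∫ τ, (invLaplace (pulseTerm α β d b p (N - 1) k) 0 τ).re :=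
      integral_add_right_eq_self
        (fun τ => (invLaplace (pulseTerm α β d b p (N - 1) k) 0 τ).re) _
    have h3 : ∫ τ, (invLaplace (pulseTerm α β d b p (N - 1) k) 0 τ).re
        = (∫ τ, invLaplace (pulseTerm α β d b p (N - 1) k) 0 τ).re :=
      Complex.reCLM.integral_comp_comm (hψint N hN)
    rw [h2, h3, h1, Complex.ofReal_re]
  -- The signal is concentrated at `(N - 1) * T` but compared with `N * T`, so its centre is `-T`, a
  -- bounded shift.
  have hbound : ∀ N, n₀ < N → ∀ τ, |φ N τ| ≤ C / √((N - 1 : ℕ) : ℝ)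
      * Real.exp (-(|τ + T| / √((N - 1 : ℕ) : ℝ))) := by
    intro N hN τ
    refine (Complex.abs_re_le_norm _).trans ((hC (N - 1) (by omega) _).trans (le_of_eq ?_))
    have : τ + N * T - ((N - 1 : ℕ) : ℝ) * T = τ + T := by
      rw [Nat.cast_sub (by omega)]
      push_cast
      ring
    rw [this]
  have hex : ∀ N, ∃ f, IsUnitPulse f ∧ tsupport f ⊆ Icc (-radius N) (radius N) ∧
      (n₀ < N → ∀ τ, |φ N τ - m * f τ|
        ≤ {τ | (N : ℝ) ^ (3 / 4 : ℝ) ≤ |τ|}.indicator (fun τ => |φ N τ|) τ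
          + (∫ τ, {τ | (N : ℝ) ^ (3 / 4 : ℝ) ≤ |τ|}.indicator (fun τ => |φ N τ|) τ)
            * unitBump.normed volume τ) := by
    intro N
    by_cases hN : n₀ < N
    · have hNpos : (0 : ℝ) < N := by
        have : 0 < N := by omega
        exact_mod_cast this
      -- The cutoff `N ^ (3 / 4)` lies between the width `√N` of the signal, so the tails vanish in
      -- the limit, and `N`, so the radius is `o(N)`.
      obtain ⟨f, h1, h2, h3⟩ := exists_unitPulse_near (hdiff N hN) (hφint N hN) hm0 (hφm N hN)
        (Real.rpow_pos_of_pos hNpos (3 / 4))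
      exact ⟨f, h1, h2, fun _ => h3⟩
    -- Default pulse for the finitely many small `N`.
    · refine ⟨_, isUnitPulse_unitBump, tsupport_unitBump_subset.trans ?_, fun h => absurd h hN⟩
      have : 1 ≤ radius N := by
        have : 0 ≤ (N : ℝ) ^ (3 / 4 : ℝ) := by positivity
        rw [radius]
        linarith
      exact Icc_subset_Icc (by linarith) this
  choose f hf1 hf2 hf3 using hex
  obtain ⟨B, hB⟩ := isUnitPulse_unitBump.compactSupport.exists_bound_of_continuous
    isUnitPulse_unitBump.differentiable.continuous
  have hB0 : 0 ≤ B := (norm_nonneg _).trans (hB 0)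
  set E : ℕ → ℝ := fun N => 8 * Real.pi * C * Real.exp (-((N : ℝ) ^ (1 / 4 : ℝ) / 4)) with hE
  -- The tail and the mass correction give `2 * E N` in the integral; for the supremum, `B * E N`
  -- bounds the bump and `C / √(N - 1)` the signal itself.
  refine ⟨f, fun N => (2 + B) * E N + C / √((N - 1 : ℕ) : ℝ), hf1, hf2, ?_, ?_⟩
  · have h1 : Tendsto E atTop (𝓝 0) := by
      have h2 : Tendsto (fun N : ℕ => (N : ℝ) ^ (1 / 4 : ℝ) / 4) atTop atTop :=
        ((tendsto_rpow_atTop (by norm_num : (0 : ℝ) < 1 / 4)).comp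
          tendsto_natCast_atTop_atTop).atTop_div_const (by norm_num)
      have h3 := (Real.tendsto_exp_neg_atTop_nhds_zero.comp h2).const_mul (8 * Real.pi * C)
      rw [mul_zero] at h3
      exact h3
    have h2 : Tendsto (fun N : ℕ => C / √((N - 1 : ℕ) : ℝ)) atTop (𝓝 0) :=
      tendsto_const_nhds.div_atTop (Real.tendsto_sqrt_atTop.comp
        (tendsto_natCast_atTop_atTop.comp (tendsto_sub_atTop_nat 1)))
    simpa using (h1.const_mul (2 + B)).add h2
  · have hlarge : ∀ᶠ N : ℕ in atTop, 2 * T ≤ (N : ℝ) ^ (3 / 4 : ℝ) :=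
      ((tendsto_rpow_atTop (by norm_num : (0 : ℝ) < 3 / 4)).comp
        tendsto_natCast_atTop_atTop).eventually_ge_atTop _
    filter_upwards [hlarge, eventually_gt_atTop n₀] with N hN1 hN2
    have hNpos : (0 : ℝ) < N := by
      have : 0 < N := by omega
      exact_mod_cast this
    have hw := hwpos N hN2
    set w := √((N - 1 : ℕ) : ℝ) with hwdef
    set ρ := (N : ℝ) ^ (3 / 4 : ℝ) with hρ
    set J := ∫ τ, {τ | ρ ≤ |τ|}.indicator (fun τ => |φ N τ|) τ with hJ
    have hJ0 : 0 ≤ J :=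
      integral_nonneg fun τ => indicator_nonneg (fun _ _ => abs_nonneg _) τ
    have hmeas : MeasurableSet {τ : ℝ | ρ ≤ |τ|} :=
      (isClosed_le continuous_const continuous_abs).measurableSet
    have hJE : J ≤ E N := by
      refine (tail_bound hC0 hw hT0 (hbound N hN2) hN1).trans ?_
      have hwN : w ≤ (N : ℝ) ^ (1 / 2 : ℝ) := by
        rw [hwdef, ← Real.sqrt_eq_rpow]
        gcongr
        omega
      have hexp : (N : ℝ) ^ (1 / 4 : ℝ) / 4 ≤ ρ / (4 * w) := by
        rw [le_div_iff₀ (by positivity)]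
        calc (N : ℝ) ^ (1 / 4 : ℝ) / 4 * (4 * w) = (N : ℝ) ^ (1 / 4 : ℝ) * w := by ring
          _ ≤ (N : ℝ) ^ (1 / 4 : ℝ) * (N : ℝ) ^ (1 / 2 : ℝ) := by gcongr
          _ = ρ := by rw [← Real.rpow_add hNpos, hρ]; norm_num
      simp only [hE]
      gcongr
    have hβ1 := isUnitPulse_unitBump
    have hintβ : Integrable (unitBump.normed (volume : Measure ℝ)) :=
      hβ1.differentiable.continuous.integrable_of_hasCompactSupport hβ1.compactSupport
    have hint1 := (hφint N hN2).abs.indicator hmeas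
    have hE0 : 0 ≤ E N := hJ0.trans hJE
    have hCw : 0 ≤ C / w := by positivity
    refine ⟨fun τ => {τ | ρ ≤ |τ|}.indicator (fun τ => |φ N τ|) τ + J * unitBump.normed volume τ,
      hint1.add (hintβ.const_mul J), ?_, fun τ => ⟨?_, hf3 N hN2 τ⟩⟩
    · rw [integral_add hint1 (hintβ.const_mul J), integral_const_mul, hβ1.integral_eq_one, ← hJ]
      nlinarith
    · have h1 : {τ | ρ ≤ |τ|}.indicator (fun τ => |φ N τ|) τ ≤ C / w := by
        refine (indicator_le_self' (fun _ _ => abs_nonneg _) τ).trans ((hbound N hN2 τ).trans ?_)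
        refine mul_le_of_le_one_right hCw (Real.exp_le_one_iff.2 ?_)
        have : 0 ≤ |τ + T| / w := by positivity
        linarith
      have h2 : J * unitBump.normed volume τ ≤ E N * B :=
        mul_le_mul hJE ((le_abs_self _).trans (hB τ)) (unitBump.nonneg_normed τ) hE0
      nlinarith

end Dispersion

/-! ### The reflection series in the time window -/

namespace Flock

open Dispersion

lemma cMinus_div_cPlus (F : Flock) : F.cMinus / F.cPlus
    = -(speed (-F.gx) (-F.drift) / speed (-F.gx) F.drift) := by
  rw [cPlus_eq, cMinus_eq, neg_div]

lemma cPlus_sub_cMinus_div (F : Flock) (hg : F.gx < 0) : (F.cPlus - F.cMinus) / F.cPlus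
    = 1 + speed (-F.gx) (-F.drift) / speed (-F.gx) F.drift := by
  have := (speed_pos (α := -F.gx) (d := F.drift) (by linarith)).ne'
  rw [cPlus_eq, cMinus_eq]
  field_simp
  ring

lemma sub_arrival (F : Flock) (t : ℝ) (N k : ℕ) :
    t - N / F.cPlus - (1 / F.cPlus - 1 / F.cMinus) * k * N
      = t - N * arrival (-F.gx) F.drift k := by
  rw [cPlus_eq, cMinus_eq, arrival, div_neg]
  ring

/-- In the window only the first few terms of the reflection series matter. -/
lemma reflectionSeries_eq_sum {F : Flock} (hg : F.gx < 0) (v₀ : ℝ) {N m : ℕ} {f : ℕ → ℝ → ℝ} {t : ℝ}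
    (h : ∀ k, m ≤ k → f k (t - N * arrival (-F.gx) F.drift k) = 0) :
    F.reflectionSeries v₀ N f t = v₀ * ∑ k ∈ Finset.range m,
      (1 + speed (-F.gx) (-F.drift) / speed (-F.gx) F.drift)
        * (-(speed (-F.gx) (-F.drift) / speed (-F.gx) F.drift)) ^ k
        * f k (t - N * arrival (-F.gx) F.drift k) := by
  rw [reflectionSeries, F.cPlus_sub_cMinus_div hg, F.cMinus_div_cPlus]
  simp only [sub_arrival]
  rw [tsum_eq_sum (s := Finset.range m) fun k hk => by
    rw [h k (by simpa using hk), mul_zero], Finset.mul_sum, mul_comm]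
  congr 1
  refine Finset.sum_congr rfl fun k _ => ?_
  ring

end Flock

open Dispersion in
theorem mainTheorem2 (F : Flock) (hF : F.Normalized) (b : LastAgent)
    (p : ℝ → ℝ) (hp : IsUnitPulse p) (v₀ : ℝ) (K : ℝ) (hK : 1 < K)
    (z : ℕ → ℕ → ℝ → ℝ) (hz : ∀ N, 1 ≤ N → IsPulseMotion F b p v₀ N (z N)) :
    ∃ (f : ℕ → ℕ → ℝ → ℝ) (r : ℕ → ℝ),
      (∀ N k, IsUnitPulse (f N k)) ∧
      (∀ N k, tsupport (f N k) ⊆ Icc (-r N) (r N)) ∧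
      Tendsto (fun N : ℕ => r N / N) atTop (𝓝 0) ∧
      ∀ ε : ℝ, 0 < ε → ∃ N₀ : ℕ, ∀ N, N₀ ≤ N →
        (∀ t ∈ F.window K N, |z N N t - F.reflectionSeries v₀ N (f N) t| < ε) ∧
        ∫ t in F.window K N, |z N N t - F.reflectionSeries v₀ N (f N) t| < ε := by
  have hα : 0 < -F.gx := by linarith [hF.gx_neg]
  have hβ : 0 < -F.gv := by linarith [hF.gv_neg]
  obtain ⟨η, hη0, hη1, hη, hreg⟩ := exists_regular hα hβ F.drift
  obtain ⟨σ, hσ, n₀, hn₀, hexp⟩ := exists_expansion hF b hp hη0 hη1 hη hreg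
  choose f ε hf1 hf2 hε hg using exists_pulses hα hβ hη0 hη1 hη hreg hp b
  set c := speed (-F.gx) F.drift with hc
  set c' := speed (-F.gx) (-F.drift) with hc'
  have hcpos : 0 < c := speed_pos hα
  have hc'pos : 0 < c' := speed_pos hα
  have hKpos : 0 < K := by linarith
  refine ⟨fun N k => f k N, radius, fun N k => hf1 k N, fun N k => hf2 k N,
    tendsto_radius_div, ?_⟩
  -- the number of relevant reflections
  obtain ⟨m, hm⟩ := exists_nat_ge (max (max 1 K) (σ * K / c))
  -- The bound `K ≤ m` puts all later arrivals after the window; the other two make the remainder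
  -- decay like `exp (-N)`.
  have hm1 : (1 : ℝ) ≤ m := ((le_max_left _ _).trans (le_max_left _ _)).trans hm
  have hmK : K ≤ m := ((le_max_right _ _).trans (le_max_left _ _)).trans hm
  have hmσ : σ * K / c ≤ m := (le_max_right _ _).trans hm
  obtain ⟨D, hD0, hD⟩ := hexp m
  -- With `t ≤ K * (N / c)` and `n = N - 1`, the exponent `σ * t - 2 * n * m` is at most `σ * K / c
  -- + 1 - N`.
  set δ : ℕ → ℝ := fun N => D * Real.exp (σ * K / c + 1) * Real.exp (-N) with hδ
  -- The factor `1 + K * (N / c)` covers both norms: the second summand bounds the length of the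
  -- window.
  set E : ℕ → ℝ := fun N =>
    |v₀| * ((∑ k ∈ Finset.range m, ε k N) + δ N * (1 + K * (N / c))) with hE
  have hElim : Tendsto E atTop (𝓝 0) := by
    have h1 : Tendsto (fun N : ℕ => ∑ k ∈ Finset.range m, ε k N) atTop (𝓝 0) := by
      simpa using tendsto_finsetSum (Finset.range m) fun k _ => hε k
    have h2 : Tendsto (fun N : ℕ => Real.exp (-(N : ℝ))) atTop (𝓝 0) :=
      Real.tendsto_exp_neg_atTop_nhds_zero.comp tendsto_natCast_atTop_atTop
    have h3 : Tendsto (fun N : ℕ => (N : ℝ) * Real.exp (-(N : ℝ))) atTop (𝓝 0) := by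
      have := (Real.tendsto_pow_mul_exp_neg_atTop_nhds_zero 1).comp tendsto_natCast_atTop_atTop
      simpa [Function.comp_def] using this
    have h4 := (h1.add ((h2.add (h3.const_mul (K / c))).const_mul
      (D * Real.exp (σ * K / c + 1)))).const_mul |v₀|
    simp only [mul_zero, add_zero] at h4
    refine h4.congr fun N => ?_
    simp only [hE, hδ]
    ring
  intro e he
  have hgall : ∀ᶠ N in atTop, ∀ k ∈ Finset.range m, ∃ g : ℝ → ℝ, Integrable g ∧
      (∫ τ, g τ) ≤ ε k N ∧ ∀ τ, g τ ≤ ε k N ∧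
        |(invLaplace (pulseTerm (-F.gx) (-F.gv) F.drift b p (N - 1) k) 0
            (τ + N * arrival (-F.gx) F.drift k)).re
          - (1 + c' / c) * (-(c' / c)) ^ k * f k N τ| ≤ g τ :=
    (Filter.eventually_all_finset _).2 fun k _ => hg k
  have hrad : ∀ᶠ N : ℕ in atTop, radius N / N < 1 / c :=
    tendsto_radius_div.eventually_lt_const (by positivity)
  obtain ⟨N₀, hN₀⟩ := eventually_atTop.1 (hgall.and (hrad.and ((eventually_gt_atTop n₀).and
    (hElim.eventually_lt_const he))))
  refine ⟨N₀, fun N hN => ?_⟩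
  obtain ⟨hg', hr, hNn, hEe⟩ := hN₀ N hN
  have hN1 : 1 ≤ N := by omega
  have hNpos : (0 : ℝ) < N := by exact_mod_cast hN1
  choose! g hgint hgI hgb using hg'
  have hgnn : ∀ k ∈ Finset.range m, ∀ τ, 0 ≤ g k τ := fun k hk τ =>
    (abs_nonneg _).trans (hgb k hk τ).2
  set G : ℝ → ℝ := fun t => |v₀| *
    ((∑ k ∈ Finset.range m, g k (t - N * arrival (-F.gx) F.drift k)) + δ N) with hG
  have hwin : ∀ t ∈ F.window K N, t ≤ K * (N / c) := by
    intro t ht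
    have := ht.2.2
    rwa [F.cPlus_eq] at this
  have hδ0 : 0 ≤ δ N := by positivity
  -- the pointwise estimate
  have hpt : ∀ t ∈ F.window K N,
      |z N N t - F.reflectionSeries v₀ N (fun k => f k N) t| ≤ G t := by
    intro t ht
    have htK := hwin t ht
    have hvan : ∀ k, m ≤ k → f k N (t - N * arrival (-F.gx) F.drift k) = 0 := by
      intro k hk
      refine image_eq_zero_of_notMem_tsupport fun h => ?_
      have h1 := (hf2 k N h).1
      -- Such a pulse arrives at least `N / c`, more than its radius, after the end `K * (N / c)` of
      -- the window.
      have h2 : (K + 1) / c ≤ arrival (-F.gx) F.drift k := by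
        have h3 : (m : ℝ) ≤ k := by exact_mod_cast hk
        have h4 : (K + 1) / c ≤ (k + 1) / c := by
          gcongr
          linarith
        have h5 : 0 ≤ (k : ℝ) / c' := by positivity
        rw [arrival]
        linarith
      rw [div_lt_iff₀ hNpos] at hr
      have h3 := mul_le_mul_of_nonneg_left h2 hNpos.le
      have h4 : (N : ℝ) * ((K + 1) / c) = K * (N / c) + 1 / c * N := by ring
      linarith
    rw [Flock.reflectionSeries_eq_sum hF.gx_neg v₀ hvan]
    have hmot : IsPulseMotion F b p v₀ (N - 1 + 1) (z N) := by
      rw [Nat.sub_add_cancel hN1]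
      exact hz N hN1
    have h1 := hD (N - 1) (by omega) v₀ (z N) hmot t
    rw [Nat.sub_add_cancel hN1] at h1
    -- The orbit is real, so passing to real parts only decreases the error, and the inverse
    -- transforms need not be shown real.
    have h2 : |z N N t - v₀ * ∑ k ∈ Finset.range m,
        (invLaplace (pulseTerm (-F.gx) (-F.gv) F.drift b p (N - 1) k) 0 t).re| ≤ |v₀| * δ N := by
      refine le_trans ?_ (h1.trans ?_)
      · refine le_trans (le_of_eq ?_) (Complex.abs_re_le_norm _)
        rw [Complex.sub_re, Complex.ofReal_re, Complex.re_ofReal_mul, Complex.re_sum]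
      · rw [mul_assoc |v₀|]
        refine mul_le_mul_of_nonneg_left ?_ (abs_nonneg v₀)
        simp only [hδ]
        rw [mul_assoc D, ← Real.exp_add]
        refine mul_le_mul_of_nonneg_left (Real.exp_le_exp.2 ?_) hD0
        rw [Nat.cast_sub hN1, Nat.cast_one]
        have h3 : σ * t ≤ σ * K / c * N := by
          calc σ * t ≤ σ * (K * (N / c)) := by gcongr
            _ = _ := by ring
        have hN1' : (0 : ℝ) ≤ N - 1 := by
          have : (1 : ℝ) ≤ N := by exact_mod_cast hN1
          linarith
        have h4 : ((N : ℝ) - 1) * (σ * K / c) ≤ (N - 1) * m := by gcongr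
        have h5 : ((N : ℝ) - 1) * 1 ≤ (N - 1) * m := by gcongr
        linarith
    have h3 : ∀ k ∈ Finset.range m,
        |(invLaplace (pulseTerm (-F.gx) (-F.gv) F.drift b p (N - 1) k) 0 t).re
          - (1 + c' / c) * (-(c' / c)) ^ k * f k N (t - N * arrival (-F.gx) F.drift k)|
        ≤ g k (t - N * arrival (-F.gx) F.drift k) := by
      intro k hk
      have := (hgb k hk (t - N * arrival (-F.gx) F.drift k)).2
      rwa [sub_add_cancel] at this
    calc _ = |(z N N t - v₀ * ∑ k ∈ Finset.range m,
            (invLaplace (pulseTerm (-F.gx) (-F.gv) F.drift b p (N - 1) k) 0 t).re)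
          + v₀ * ∑ k ∈ Finset.range m,
            ((invLaplace (pulseTerm (-F.gx) (-F.gv) F.drift b p (N - 1) k) 0 t).re
            - (1 + c' / c) * (-(c' / c)) ^ k * f k N (t - N * arrival (-F.gx) F.drift k))| := by
          rw [Finset.sum_sub_distrib]
          congr 1
          ring
      _ ≤ |v₀| * δ N + |v₀| * ∑ k ∈ Finset.range m, g k (t - N * arrival (-F.gx) F.drift k) := by
          refine (abs_add_le _ _).trans (add_le_add h2 ?_)
          rw [abs_mul]
          exact mul_le_mul_of_nonneg_left
            ((Finset.abs_sum_le_sum_abs _ _).trans (Finset.sum_le_sum h3)) (abs_nonneg _)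
      _ = G t := by simp only [hG]; ring
  constructor
  · intro t ht
    refine ((hpt t ht).trans ?_).trans_lt hEe
    simp only [hG, hE]
    gcongr with k hk
    · exact (hgb k hk _).1
    · refine le_mul_of_one_le_right hδ0 ?_
      have : 0 ≤ K * (N / c) := by positivity
      linarith
  · refine lt_of_le_of_lt ?_ hEe
    set S : ℝ → ℝ := fun t => ∑ k ∈ Finset.range m, g k (t - N * arrival (-F.gx) F.drift k) with hS
    have hSint : Integrable S :=
      integrable_finsetSum _ fun k hk => (hgint k hk).comp_sub_right _
    have hWsub : F.window K N ⊆ Icc 0 (K * (N / c)) := by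
      intro t ht
      have h1 := ht.2.1
      rw [F.cPlus_eq] at h1
      exact ⟨le_trans (by positivity) h1, hwin t ht⟩
    have hWfin : volume (F.window K N) ≠ ⊤ :=
      ((measure_mono hWsub).trans_lt measure_Icc_lt_top).ne
    have hWmeas : MeasurableSet (F.window K N) := measurableSet_Icc.inter measurableSet_Icc
    have hWvol : (volume.real (F.window K N)) ≤ K * (N / c) := by
      refine (measureReal_mono hWsub measure_Icc_lt_top.ne).trans (le_of_eq ?_)
      rw [Real.volume_real_Icc_of_le (by positivity), sub_zero]
    have hconst : IntegrableOn (fun _ : ℝ => δ N) (F.window K N) := integrableOn_const hWfin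
    calc _ ≤ ∫ t in F.window K N, G t := by
          refine integral_mono_of_nonneg (Eventually.of_forall fun t => abs_nonneg _) ?_ ?_
          · exact (hSint.integrableOn.add hconst).const_mul _
          · exact (ae_restrict_iff' hWmeas).2 (Eventually.of_forall hpt)
      _ = |v₀| * ((∫ t in F.window K N, S t) + volume.real (F.window K N) * δ N) := by
          simp only [hG]
          rw [integral_const_mul, integral_add hSint.integrableOn hconst, setIntegral_const,
            smul_eq_mul]
      _ ≤ E N := by
          simp only [hE]
          refine mul_le_mul_of_nonneg_left (add_le_add ?_ ?_) (abs_nonneg _)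
          · calc ∫ t in F.window K N, S t ≤ ∫ t, S t :=
                setIntegral_le_integral hSint (Eventually.of_forall fun t =>
                  Finset.sum_nonneg fun k hk => hgnn k hk _)
              _ = ∑ k ∈ Finset.range m, ∫ t, g k (t - N * arrival (-F.gx) F.drift k) :=
                integral_finsetSum _ fun k hk => (hgint k hk).comp_sub_right _
              _ ≤ ∑ k ∈ Finset.range m, ε k N := by
                refine Finset.sum_le_sum fun k hk => ?_
                rw [integral_sub_right_eq_self]
                exact hgI k hk
          · rw [mul_comm]
            refine mul_le_mul_of_nonneg_left ?_ hδ0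
            linarith
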